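/- For a finite simple graph $H$ of order $m$, let $P(H,x)$ be its chromatic polynomial, i.e. the polynomial such that $P(H,k)$ is the number of proper $k$-colorings of $H$ for every positive integer $k$, and define the numbers $a_i(H)$ by $$P(H,x)=\sum_{i=0}^{m}(-1)^{m-i}a_i(H)\,x^i,$$ with $a_i(H)=0$ for $i>m$. Let $G=(V,E)$ be a finite simple graph of order $n$ that is not complete, and let $c$ be the number of connected components of $G$. For $u\in V$ let $G-u$ be the subgraph of $G$ induced by $V\setminus\{u\}$, and for $i=1,2,\dots,n$ put $$d_i=\sum_{u\in V}\bigl[a_{i-1}(G-u)+(n-1)\,a_i(G-u)\bigr]-n\,a_i(G).$$ Then $d_i\ge 0$ for every $i=1,2,\dots,n$, and $d_i=0$ holds if and only if at least one of the following holds: 1. $i=n$; 2. $1\le i\le c-2$; 3. $i=c-1$ and $G$ has no isolated vertices; 4. $i=c=1$ and $G$ is isomorphic to the cycle $C_n$ on $n$ vertices. -/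

import Mathlib

open Polynomial

namespace ChromaticCoeff

universe u

/-- Functions on the vertices that are constant along every edge of `H` are the functions on the
connected components of `H`. -/
theorem card_edgeConstant {V : Type u} [Finite V] (H : SimpleGraph V) (k : ℕ) :
    Nat.card {f : V → Fin k // ∀ v w, H.Adj v w → f v = f w} =
      k ^ Nat.card H.ConnectedComponent := by
  have e : {f : V → Fin k // ∀ v w, H.Adj v w → f v = f w} ≃ (H.ConnectedComponent → Fin k) :=
    { toFun := fun f => SimpleGraph.ConnectedComponent.lift f.1 (by
        intro v w p hp
        clear hp
        induction p with
        | nil => rfl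
        | cons h p ih => exact (f.2 _ _ h).trans ih)
      invFun := fun g => ⟨fun v => g (H.connectedComponentMk v), fun v w h =>
        congrArg g (SimpleGraph.ConnectedComponent.sound h.reachable)⟩
      left_inv := fun f => by ext v; rfl
      right_inv := fun g => by
        funext c
        induction c using SimpleGraph.ConnectedComponent.ind
        rfl }
  rw [Nat.card_congr e, Nat.card_fun, Nat.card_fin]

open Classical in
/-- The number of proper `k`-colorings is a polynomial function of `k`. -/
theorem card_coloring_eq_sum {V : Type u} [Finite V] (G : SimpleGraph V) (k : ℕ) :
    (Nat.card (G.Coloring (Fin k)) : ℤ) =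
      ∑ A ∈ (Set.toFinite G.edgeSet).toFinset.powerset, (-1 : ℤ) ^ A.card *
        (k : ℤ) ^ Nat.card (SimpleGraph.fromEdgeSet (A : Set (Sym2 V))).ConnectedComponent := by
  have : Fintype V := Fintype.ofFinite V
  let m : (V → Fin k) → Sym2 V → ℤ := fun f e =>
    if (e.map f).IsDiag then 1 else 0
  have hcol : (Nat.card (G.Coloring (Fin k)) : ℤ) =
      ∑ f : V → Fin k, ∏ e ∈ (Set.toFinite G.edgeSet).toFinset, (1 - m f e) := by
    have e : G.Coloring (Fin k) ≃ {f : V → Fin k // ∀ v w, G.Adj v w → f v ≠ f w} :=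
      { toFun := fun C => ⟨C, fun v w h => C.valid h⟩
        invFun := fun f => SimpleGraph.Coloring.mk f.1 (fun {v w} h => f.2 v w h)
        left_inv := fun C => by ext v; rfl
        right_inv := fun f => rfl }
    rw [Nat.card_congr e, Nat.card_eq_fintype_card, Fintype.card_subtype, Finset.card_filter,
      Nat.cast_sum]
    refine Finset.sum_congr rfl fun f _ => ?_
    split_ifs with h
    · rw [Finset.prod_eq_one, Nat.cast_one]
      intro e he
      induction e using Sym2.ind with
      | _ v w =>
        have := h v w (by simpa using he)
        simp [m, this]
    · push Not at h
      obtain ⟨v, w, hvw, hf⟩ := h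
      rw [Finset.prod_eq_zero (i := s(v, w)) (by simpa using hvw) (by simp [m, hf])]
      rfl
  rw [hcol]
  simp_rw [Finset.prod_sub, Finset.prod_const_one, mul_one]
  rw [Finset.sum_comm]
  refine Finset.sum_congr rfl fun A hA => ?_
  rw [← Finset.mul_sum]
  congr 1
  rw [← Nat.cast_pow, ← card_edgeConstant, Nat.card_eq_fintype_card, Fintype.card_subtype,
    Finset.card_filter, Nat.cast_sum]
  refine Finset.sum_congr rfl fun f _ => ?_
  split_ifs with h
  · rw [Finset.prod_eq_one, Nat.cast_one]
    intro e he
    induction e using Sym2.ind with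
    | _ v w =>
      have hG : G.Adj v w := by simpa using Finset.mem_powerset.1 hA he
      have := h v w (by simp [SimpleGraph.fromEdgeSet_adj, hG.ne, he])
      simp [m, this]
  · push Not at h
    obtain ⟨v, w, hvw, hf⟩ := h
    rw [SimpleGraph.fromEdgeSet_adj] at hvw
    rw [Finset.prod_eq_zero (i := s(v, w)) (by simpa using hvw.1) (by simp [m, hf])]
    rfl

/-- There is exactly one polynomial whose value at every positive integer `k` is the number of
proper `k`-colorings. -/
theorem existsUnique_chromaticPolynomial {V : Type u} [Finite V] (G : SimpleGraph V) :
    ∃! P : ℤ[X], ∀ k : ℕ, 1 ≤ k → P.eval (k : ℤ) = (Nat.card (G.Coloring (Fin k)) : ℤ) := by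
  refine ⟨∑ A ∈ (Set.toFinite G.edgeSet).toFinset.powerset, (-1 : ℤ[X]) ^ A.card *
    X ^ Nat.card (SimpleGraph.fromEdgeSet (A : Set (Sym2 V))).ConnectedComponent, ?_, ?_⟩
  · intro k _
    rw [card_coloring_eq_sum]
    simp [eval_finsetSum]
  · intro Q hQ
    refine Polynomial.eq_of_infinite_eval_eq _ _ ?_
    refine Set.Infinite.mono (s := (fun k : ℕ => (k : ℤ)) '' Set.Ici 1) ?_
      ((Set.Ici_infinite 1).image Nat.cast_injective.injOn)
    rintro _ ⟨k, hk, rfl⟩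
    simp only [Set.mem_ofPred_eq]
    rw [hQ k hk, card_coloring_eq_sum]
    simp [eval_finsetSum]

/-- The chromatic polynomial `P(G, x)`: the polynomial with `P(G, k)` the number of proper
`k`-colorings of `G` for every positive integer `k`. -/
noncomputable def chromaticPolynomial {V : Type u} [Finite V] (G : SimpleGraph V) : ℤ[X] :=
  (existsUnique_chromaticPolynomial G).choose

theorem chromaticPolynomial_eval {V : Type u} [Finite V] (G : SimpleGraph V) (k : ℕ)
    (hk : 1 ≤ k) :
    (chromaticPolynomial G).eval (k : ℤ) = (Nat.card (G.Coloring (Fin k)) : ℤ) :=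
  (existsUnique_chromaticPolynomial G).choose_spec.1 k hk

/-- The number `a_i(G)` in `P(G, x) = ∑ i, (-1) ^ (n - i) * a_i(G) * x ^ i`, where `n` is the order
of `G`. For `i > n` the coefficient of `x ^ i`, and hence `a_i(G)`, is zero. -/
noncomputable def a {V : Type u} [Finite V] (G : SimpleGraph V) (i : ℕ) : ℤ :=
  (-1) ^ (Nat.card V - i) * (chromaticPolynomial G).coeff i

/-- The graph `G - u`, the subgraph induced by all vertices other than `u`. -/
abbrev deleteVertex {V : Type u} (G : SimpleGraph V) (u : V) :
    SimpleGraph ({u}ᶜ : Set V) :=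
  G.induce ({u}ᶜ : Set V)

/-- The number `d_i = ∑ u, [a_{i-1}(G-u) + (n-1) a_i(G-u)] - n a_i(G)`, for `1 ≤ i`. -/
noncomputable def d {V : Type u} [Fintype V] (G : SimpleGraph V) (i : ℕ) : ℤ :=
  ∑ u : V, (a (deleteVertex G u) (i - 1) + ((Nat.card V : ℤ) - 1) * a (deleteVertex G u) i) -
    (Nat.card V : ℤ) * a G i

end ChromaticCoeff

set_option linter.unusedSectionVars false

/-! Everything reduces to the case `i = 1` on induced subgraphs. Counting colorings of `G[S]` that
avoid one fixed color on `N` gives a polynomial with coefficients `q G N S j` up to sign. It obeys a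
deletion recursion (`q_step`), and for `N` disjoint from nonempty `S` a factor `X` splits off at any
root (`q_root_succ`). Hence `q` is nonnegative and satisfies the convolution `q_eq_sum`. Rooting at
every vertex yields `card_mul_q`, and then `d_eq_sum`: `d_{i+1}(G)` is the sum over vertex sets `T`
of `d_1(G[T]) * a_i(G - T)`, where `d_1(G[T])` is `linearDefect G T`. For `|T| > 1` the defect is a
sum of `excess` terms, which satisfy the same deletion recursion and are nonnegative on nonempty
sets. So `d_{i+1}` is nonnegative, and vanishes exactly when every product in the sum does.

The second factors are controlled by connectivity: `a_j(G[S])` is nonzero exactly when some `j`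
vertices of `S` meet all components of `G[S]` (`Anchored`). For the first factors, a nonzero defect
forces `T` minus some vertex to be nonempty and connected. Conversely the defect is positive when
`T` is a nonempty connected set plus one vertex with no neighbor in it, or plus two nonadjacent
vertices each with a neighbor in it. Cycles have defect zero because deleting a root leaves a path
with both ends marked.

For disconnected `G` a suitable `T` is a component plus a vertex outside it, or two vertices from
different components. For connected noncomplete `G` one looks for nonadjacent `x`, `y` with `G - x -
y` connected and nonempty. If no such pair exists, `G` is 2-regular, hence a cycle; even then `d_i`
is nonzero for `1 < i < n`. -/

namespace ChromaticCoeff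

/-! ### Colorings avoiding a color on a marked set, and their coefficients -/

section RootedPolynomial

variable {V : Type*} [Fintype V] [DecidableEq V] (G : SimpleGraph V)

open Classical in
/-- The neighbours of `v`, as a finset. -/
noncomputable def nbrs (v : V) : Finset V := Finset.univ.filter (G.Adj v)

theorem mem_nbrs {v w : V} : w ∈ nbrs G v ↔ G.Adj v w := by simp [nbrs]

open Classical in
/-- The proper colorings of `G[S]` with colors `0, …, k` that avoid the color `0` on `N`, extended by
`0` outside `S`. -/
noncomputable def rootedColorings (N S : Finset V) (k : ℕ) : Finset (V → Fin (k + 1)) :=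
  Finset.univ.filter fun f => (∀ v ∉ S, f v = 0) ∧
    (∀ v ∈ S, ∀ w ∈ S, G.Adj v w → f v ≠ f w) ∧ ∀ v ∈ N, v ∈ S → f v ≠ 0

theorem mem_rootedColorings {N S : Finset V} {k : ℕ} {f : V → Fin (k + 1)} :
    f ∈ rootedColorings G N S k ↔ (∀ v ∉ S, f v = 0) ∧
      (∀ v ∈ S, ∀ w ∈ S, G.Adj v w → f v ≠ f w) ∧ ∀ v ∈ N, v ∈ S → f v ≠ 0 := by
  simp [rootedColorings]

theorem rootedColorings_congr {N N' S : Finset V} (h : ∀ v ∈ S, v ∈ N ↔ v ∈ N') (k : ℕ) :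
    rootedColorings G N S k = rootedColorings G N' S k := by
  ext f
  simp only [mem_rootedColorings]
  refine and_congr_right fun _ => and_congr_right fun _ => ?_
  exact ⟨fun H v hv hS => H v ((h v hS).2 hv) hS, fun H v hv hS => H v ((h v hS).1 hv) hS⟩

/-- Since `0` is also the default value outside `S`, the same function serves on both sides: a
vertex colored `0` may be deleted once its neighbors are forbidden `0`. -/
theorem filter_eq_rootedColorings {N S : Finset V} {v : V} (hv : v ∈ S) (hN : v ∉ N) (k : ℕ) :
    (rootedColorings G N S k).filter (fun f => f v = 0) =
      rootedColorings G (N ∪ nbrs G v) (S.erase v) k := by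
  ext f
  simp only [Finset.mem_filter, mem_rootedColorings, Finset.mem_erase, Finset.mem_union, mem_nbrs]
  constructor
  · rintro ⟨⟨h1, h2, h3⟩, h0⟩
    refine ⟨fun w hw => ?_, fun w hw x hx => h2 w hw.2 x hx.2, ?_⟩
    · by_cases h : w = v
      · rw [h, h0]
      · exact h1 w fun h' => hw ⟨h, h'⟩
    · rintro w (hw | hw) hS
      · exact h3 w hw hS.2
      · rw [← h0]
        exact (h2 v hv w hS.2 hw).symm
  · rintro ⟨h1, h2, h3⟩
    have h0 : f v = 0 := h1 v fun h => h.1 rfl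
    refine ⟨⟨fun w hw => h1 w fun h => hw h.2, fun w hw x hx hwx => ?_, fun w hw hS => ?_⟩, h0⟩
    · by_cases hwv : w = v
      · subst hwv
        rw [h0]
        exact (h3 x (Or.inr hwx) ⟨hwx.ne', hx⟩).symm
      · by_cases hxv : x = v
        · subst hxv
          rw [h0]
          exact h3 w (Or.inr hwx.symm) ⟨hwv, hw⟩
        · exact h2 w ⟨hwv, hw⟩ x ⟨hxv, hx⟩ hwx
    · exact h3 w (Or.inl hw) ⟨fun h => hN (h ▸ hw), hS⟩

theorem card_rootedColorings_erase {N S : Finset V} {v : V} (hN : v ∈ N) (hS : v ∈ S) (k : ℕ) :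
    (rootedColorings G (N.erase v) S k).card =
      (rootedColorings G N S k).card + (rootedColorings G (N ∪ nbrs G v) (S.erase v) k).card := by
  rw [← Finset.card_filter_add_card_filter_not (s := rootedColorings G (N.erase v) S k)
    (fun f => f v = 0), filter_eq_rootedColorings G hS (Finset.notMem_erase v N), add_comm]
  congr 2
  · ext f
    simp only [Finset.mem_filter, mem_rootedColorings, Finset.mem_erase]
    constructor
    · rintro ⟨⟨h1, h2, h3⟩, h0⟩
      refine ⟨h1, h2, fun w hw hwS => ?_⟩
      by_cases h : w = v
      · rwa [h]
      · exact h3 w ⟨h, hw⟩ hwS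
    · rintro ⟨h1, h2, h3⟩
      exact ⟨⟨h1, h2, fun w hw => h3 w hw.2⟩, h3 v hN hS⟩
  · refine rootedColorings_congr G (fun w hw => ?_) k
    simp [Finset.ne_of_mem_erase hw]

theorem card_rootedColorings_root {N S : Finset V} {r : V} (hr : r ∈ S) (hN : Disjoint N S)
    (k : ℕ) : (rootedColorings G N S k).card =
      (k + 1) * (rootedColorings G (nbrs G r) (S.erase r) k).card := by
  rw [rootedColorings_congr G (N' := ∅) (by
    intro v hv
    simpa using fun h => Finset.disjoint_left.1 hN h hv),
    Finset.card_eq_sum_card_fiberwise (f := fun f => f r) (t := Finset.univ) (by simp)]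
  rw [Finset.sum_const_nat (m := (rootedColorings G (nbrs G r) (S.erase r) k).card)]
  · simp
  · intro c _
    rw [← Finset.empty_union (nbrs G r), ← filter_eq_rootedColorings G hr (Finset.notMem_empty r)]
    -- With no marked vertex in `S` the colors are interchangeable, so all `k + 1` fibers over the
    -- color of `r` have equal size. The swap acts on `S` only, to keep the default `0` outside.
    have key : ∀ c c' : Fin (k + 1), ∀ f ∈ (rootedColorings G ∅ S k).filter (fun f => f r = c),
        (fun v => if v ∈ S then Equiv.swap c c' (f v) else 0) ∈
          (rootedColorings G ∅ S k).filter (fun f => f r = c') := by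
      intro c c' f hf
      simp only [Finset.mem_filter, mem_rootedColorings] at hf ⊢
      refine ⟨⟨fun v hv => by simp [hv], fun v hv w hw h => ?_, by simp⟩, by simp [hr, hf.2]⟩
      simpa [hv, hw] using hf.1.2.1 v hv w hw h
    have inv : ∀ c c' : Fin (k + 1), ∀ f ∈ (rootedColorings G ∅ S k).filter (fun f => f r = c),
        (fun v => if v ∈ S then Equiv.swap c' c (if v ∈ S then Equiv.swap c c' (f v) else 0)
          else 0) = f := by
      intro c c' f hf
      simp only [Finset.mem_filter, mem_rootedColorings] at hf
      funext v
      by_cases hv : v ∈ S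
      · simp [hv, Equiv.swap_comm c' c]
      · simp [hv, hf.1.1 v hv]
    exact Finset.card_nbij' (fun f v => if v ∈ S then Equiv.swap c 0 (f v) else 0)
      (fun f v => if v ∈ S then Equiv.swap 0 c (f v) else 0) (key c 0) (key 0 c) (inv c 0) (inv 0 c)

theorem card_rootedColorings_empty (N : Finset V) (k : ℕ) :
    (rootedColorings G N ∅ k).card = 1 := by
  rw [Finset.card_eq_one]
  refine ⟨fun _ => 0, ?_⟩
  ext f
  simp [mem_rootedColorings, funext_iff]

/-- Induction along the recursion satisfied by rooted colorings. -/
theorem rooted_induction {p : Finset V → Finset V → Prop} (empty : ∀ N, p N ∅)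
    (root : ∀ N S, S.Nonempty → Disjoint N S → (∀ r ∈ S, p (nbrs G r) (S.erase r)) → p N S)
    (step : ∀ N S, ∀ v ∈ N, v ∈ S → p (N.erase v) S → p (N ∪ nbrs G v) (S.erase v) → p N S)
    (N S : Finset V) : p N S := by
  induction hs : S.card using Nat.strong_induction_on generalizing N S with
  | _ s ihS =>
    induction hm : N.card using Nat.strong_induction_on generalizing N with
    | _ m ihN =>
      by_cases hd : Disjoint N S
      · rcases S.eq_empty_or_nonempty with rfl | hne
        · exact empty N
        · exact root N S hne hd fun r hr =>
            ihS _ (hs ▸ Finset.card_erase_lt_of_mem hr) _ _ rfl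
      · obtain ⟨v, hN, hS⟩ := Finset.not_disjoint_iff.1 hd
        exact step N S v hN hS (ihN _ (hm ▸ Finset.card_erase_lt_of_mem hN) _ rfl)
          (ihS _ (hs ▸ Finset.card_erase_lt_of_mem hS) _ _ rfl)

theorem exists_rootedPolynomial (N S : Finset V) :
    ∃ P : ℤ[X], ∀ k : ℕ, P.eval ((k : ℤ) + 1) = (rootedColorings G N S k).card := by
  induction N, S using rooted_induction G with
  | empty N => exact ⟨1, fun k => by simp [card_rootedColorings_empty]⟩
  | root N S hne hN ih =>
    obtain ⟨r, hr⟩ := hne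
    obtain ⟨P, hP⟩ := ih r hr
    exact ⟨X * P, fun k => by simp [hP, card_rootedColorings_root G hr hN]⟩
  | step N S v hN hS ih1 ih2 =>
    obtain ⟨P, hP⟩ := ih1
    obtain ⟨P', hP'⟩ := ih2
    exact ⟨P - P', fun k => by simp [hP, hP', card_rootedColorings_erase G hN hS]⟩

/-- The polynomial counting the proper colorings of `G[S]` that avoid one given color on `N`. -/
noncomputable def rootedPolynomial (N S : Finset V) : ℤ[X] :=
  (exists_rootedPolynomial G N S).choose

theorem rootedPolynomial_eval (N S : Finset V) (k : ℕ) :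
    (rootedPolynomial G N S).eval ((k : ℤ) + 1) = (rootedColorings G N S k).card :=
  (exists_rootedPolynomial G N S).choose_spec k

theorem eq_of_eval_succ {P P' : ℤ[X]}
    (h : ∀ k : ℕ, P.eval ((k : ℤ) + 1) = P'.eval ((k : ℤ) + 1)) : P = P' := by
  refine Polynomial.eq_of_infinite_eval_eq _ _ ?_
  refine (Set.infinite_range_of_injective (f := fun k : ℕ => (k : ℤ) + 1) ?_).mono ?_
  · intro k l hkl
    simpa using hkl
  · rintro _ ⟨k, rfl⟩
    exact h k

theorem rootedPolynomial_congr {N N' S : Finset V} (h : ∀ v ∈ S, v ∈ N ↔ v ∈ N') :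
    rootedPolynomial G N S = rootedPolynomial G N' S :=
  eq_of_eval_succ fun k => by simp only [rootedPolynomial_eval, rootedColorings_congr G h]

theorem rootedPolynomial_empty (N : Finset V) : rootedPolynomial G N ∅ = 1 :=
  eq_of_eval_succ fun k => by simp [rootedPolynomial_eval, card_rootedColorings_empty]

theorem rootedPolynomial_root {N S : Finset V} {r : V} (hr : r ∈ S) (hN : Disjoint N S) :
    rootedPolynomial G N S = X * rootedPolynomial G (nbrs G r) (S.erase r) :=
  eq_of_eval_succ fun k => by
    simp [rootedPolynomial_eval, card_rootedColorings_root G hr hN]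

theorem rootedPolynomial_step {N S : Finset V} {v : V} (hN : v ∈ N) (hS : v ∈ S) :
    rootedPolynomial G N S = rootedPolynomial G (N.erase v) S -
      rootedPolynomial G (N ∪ nbrs G v) (S.erase v) :=
  eq_of_eval_succ fun k => by
    simp [rootedPolynomial_eval, card_rootedColorings_erase G hN hS]

/-- The absolute values of the coefficients of `rootedPolynomial`. -/
noncomputable def q (N S : Finset V) (j : ℕ) : ℤ :=
  (-1) ^ (S.card + j) * (rootedPolynomial G N S).coeff j

theorem q_congr {N N' S : Finset V} (h : ∀ v ∈ S, v ∈ N ↔ v ∈ N') (j : ℕ) :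
    q G N S j = q G N' S j := by
  rw [q, q, rootedPolynomial_congr G h]

theorem q_empty (N : Finset V) (j : ℕ) : q G N ∅ j = if j = 0 then 1 else 0 := by
  rw [q, rootedPolynomial_empty, coeff_one]
  split_ifs with h <;> simp [h]

theorem q_root_zero {N S : Finset V} (hS : S.Nonempty) (hN : Disjoint N S) : q G N S 0 = 0 := by
  obtain ⟨r, hr⟩ := hS
  rw [q, rootedPolynomial_root G hr hN]
  simp

theorem q_root_succ {N S : Finset V} {r : V} (hr : r ∈ S) (hN : Disjoint N S) (j : ℕ) :
    q G N S (j + 1) = q G (nbrs G r) (S.erase r) j := by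
  rw [q, q, rootedPolynomial_root G hr hN, coeff_X_mul, ← Finset.card_erase_add_one hr]
  congr 1
  ring

theorem q_step {N S : Finset V} {v : V} (hN : v ∈ N) (hS : v ∈ S) (j : ℕ) :
    q G N S j = q G (N.erase v) S j + q G (N ∪ nbrs G v) (S.erase v) j := by
  rw [q, q, q, rootedPolynomial_step G hN hS, coeff_sub, ← Finset.card_erase_add_one hS]
  ring

theorem q_nonneg (N S : Finset V) (j : ℕ) : 0 ≤ q G N S j := by
  induction N, S using rooted_induction G generalizing j with
  | empty N =>
    rw [q_empty]
    positivity
  | root N S hne hN ih =>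
    cases j with
    | zero => rw [q_root_zero G hne hN]
    | succ j =>
      obtain ⟨r, hr⟩ := hne
      rw [q_root_succ G hr hN]
      exact ih r hr j
  | step N S v hN hS ih1 ih2 =>
    rw [q_step G hN hS]
    exact add_nonneg (ih1 j) (ih2 j)

/-- Both sides obey the same recursion at `v`: a block `T` avoiding `v` does not see whether `v` is
marked, and a block containing `v` splits by `q_step`. When `N` misses `S`, only `T = ∅`
contributes. -/
theorem q_eq_sum (N S : Finset V) (j : ℕ) :
    q G N S j = ∑ T ∈ S.powerset, q G N T 0 * q G ∅ (S \ T) j := by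
  have base : ∀ N S : Finset V, Disjoint N S →
      q G N S j = ∑ T ∈ S.powerset, q G N T 0 * q G ∅ (S \ T) j := by
    intro N S hN
    rw [Finset.sum_eq_single ∅]
    · simp only [q_empty, if_true, one_mul, Finset.sdiff_empty]
      exact q_congr G (fun v hv => by simpa using fun h => Finset.disjoint_left.1 hN h hv) j
    · intro T hT hne
      rw [q_root_zero G (Finset.nonempty_iff_ne_empty.2 hne)
        (hN.mono_right (Finset.mem_powerset.1 hT)), zero_mul]
    · simp
  induction N, S using rooted_induction G with
  | empty N => exact base _ _ (Finset.disjoint_empty_right N)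
  | root N S hne hN ih => exact base _ _ hN
  | step N S v hN hS ih1 ih2 =>
    rw [q_step G hN hS, ih1, ih2]
    have hv : v ∉ S.erase v := Finset.notMem_erase v S
    have hins : insert v (S.erase v) = S := Finset.insert_erase hS
    rw [← hins, Finset.sum_powerset_insert hv, Finset.sum_powerset_insert hv, hins, add_assoc,
      ← Finset.sum_add_distrib]
    congr 1
    · refine Finset.sum_congr rfl fun T hT => ?_
      have hvT : v ∉ T := fun h => hv (Finset.mem_powerset.1 hT h)
      rw [q_congr G (N := N.erase v) (N' := N)]
      intro w hw
      simp [show w ≠ v from fun h => hvT (h ▸ hw)]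
    · refine Finset.sum_congr rfl fun T hT => ?_
      have hvT : v ∉ T := fun h => hv (Finset.mem_powerset.1 hT h)
      rw [q_step G hN (Finset.mem_insert_self v T), Finset.erase_insert hvT, add_mul]
      congr 3
      ext w
      simp only [Finset.mem_sdiff, Finset.mem_erase, Finset.mem_insert]
      tauto

end RootedPolynomial

/-! ### Reduction of `d` to linear defects, and nonnegativity -/

section Expansion

variable {V : Type*} [Fintype V] [DecidableEq V] (G : SimpleGraph V)

theorem q_eq_zero_of_card_lt {N S : Finset V} {j : ℕ} (h : S.card < j) : q G N S j = 0 := by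
  induction N, S using rooted_induction G generalizing j with
  | empty N =>
    rw [q_empty, if_neg]
    rintro rfl
    simp at h
  | root N S hne hN ih =>
    obtain ⟨r, hr⟩ := hne
    cases j with
    | zero => simp at h
    | succ j =>
      rw [q_root_succ G hr hN]
      refine ih r hr ?_
      rw [← Finset.card_erase_add_one hr] at h
      lia
  | step N S v hN hS ih1 ih2 =>
    rw [q_step G hN hS, ih1 h, ih2 (lt_of_le_of_lt (Finset.card_erase_le) h), add_zero]

theorem chromaticPolynomial_eq_of_embedding {W : Type*} [Finite W] {H : SimpleGraph W}
    (e : H ↪g G) {S : Finset V} (hS : ∀ v, v ∈ S ↔ ∃ w, e w = v) :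
    chromaticPolynomial H = rootedPolynomial G ∅ S := by
  refine eq_of_eval_succ fun k => ?_
  have := chromaticPolynomial_eval H (k + 1) (by lia)
  push_cast at this
  rw [this, rootedPolynomial_eval, ← Nat.card_eq_finsetCard]
  congr 1
  have heS : ∀ w, e w ∈ S := fun w => (hS _).2 ⟨w, rfl⟩
  refine Nat.card_congr
    { toFun := fun C => ⟨Function.extend e C 0, ?_⟩
      invFun := fun f => SimpleGraph.Coloring.mk (fun w => f.1 (e w)) ?_
      left_inv := fun C => ?_
      right_inv := fun f => ?_ }
  · rw [mem_rootedColorings]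
    refine ⟨fun v hv => ?_, fun v hv w hw h => ?_, by simp⟩
    · rw [Function.extend_apply' _ _ _ (fun h => hv ((hS v).2 h))]
      rfl
    · obtain ⟨x, rfl⟩ := (hS v).1 hv
      obtain ⟨y, rfl⟩ := (hS w).1 hw
      rw [e.injective.extend_apply, e.injective.extend_apply]
      exact C.valid (e.map_adj_iff.1 h)
  · intro x y h
    exact ((mem_rootedColorings G).1 f.2).2.1 _ (heS x) _ (heS y) (e.map_adj_iff.2 h)
  · ext w
    exact congrArg Fin.val (e.injective.extend_apply _ _ w)
  · ext v
    refine congrArg Fin.val ?_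
    by_cases hv : v ∈ S
    · obtain ⟨x, rfl⟩ := (hS v).1 hv
      exact e.injective.extend_apply _ _ x
    · rw [((mem_rootedColorings G).1 f.2).1 v hv]
      exact Function.extend_apply' _ _ _ (fun h => hv ((hS v).2 h))

theorem a_eq_q_of_embedding {W : Type*} [Finite W] {H : SimpleGraph W}
    (e : H ↪g G) {S : Finset V} (hS : ∀ v, v ∈ S ↔ ∃ w, e w = v) (i : ℕ) :
    a H i = q G ∅ S i := by
  have hcard : Nat.card W = S.card := by
    rw [← Nat.card_eq_finsetCard]
    exact Nat.card_congr (Equiv.ofBijective (fun w => (⟨e w, (hS _).2 ⟨w, rfl⟩⟩ : S))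
      ⟨fun x y h => e.injective (congrArg Subtype.val h),
        fun v => ((hS v.1).1 v.2).imp fun w hw => Subtype.ext hw⟩)
  rw [a, chromaticPolynomial_eq_of_embedding G e hS, hcard]
  rcases le_or_gt i S.card with h | h
  · rw [q]
    congr 1
    obtain ⟨m, hm⟩ := Nat.exists_eq_add_of_le h
    -- The sign exponents `|S| - i` in `a` and `|S| + i` in `q` differ by the even number `2 * i`.
    rw [hm, Nat.add_sub_cancel_left, show i + m + i = 2 * i + m by ring, pow_add, pow_mul]
    simp
  · have h0 := q_eq_zero_of_card_lt G (N := ∅) h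
    have h1 : (rootedPolynomial G ∅ S).coeff i = 0 := by
      rw [q, mul_eq_zero] at h0
      exact h0.resolve_left (pow_ne_zero _ (by norm_num))
    rw [h0, h1, mul_zero]

theorem a_eq_q (i : ℕ) : a G i = q G ∅ Finset.univ i :=
  a_eq_q_of_embedding G (SimpleGraph.Embedding.refl) (fun v => by simp) i

theorem a_deleteVertex_eq_q (u : V) (i : ℕ) :
    a (deleteVertex G u) i = q G ∅ (Finset.univ.erase u) i :=
  a_eq_q_of_embedding G (SimpleGraph.Embedding.induce _) (fun v => by simp) i

/-- The sum over all roots of the linear coefficients of `G[T]`. -/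
noncomputable def rootWeight (T : Finset V) : ℤ := ∑ r ∈ T, q G (nbrs G r) (T.erase r) 0

theorem sum_powerset_erase {M : Type*} [AddCommMonoid M] {S : Finset V} {r : V} (hr : r ∈ S)
    (g : Finset V → M) :
    ∑ T ∈ (S.erase r).powerset, g T = ∑ T ∈ S.powerset, if r ∈ T then g (T.erase r) else 0 := by
  rw [← Finset.sum_filter]
  refine Finset.sum_nbij' (fun T => insert r T) (fun T => T.erase r) ?_ ?_ ?_ ?_ ?_
  · intro T hT
    rw [Finset.mem_powerset] at hT
    simp only [Finset.mem_filter, Finset.mem_powerset, Finset.mem_insert_self, and_true]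
    exact Finset.insert_subset hr (hT.trans (Finset.erase_subset _ _))
  · intro T hT
    simp only [Finset.mem_filter, Finset.mem_powerset] at hT ⊢
    exact Finset.erase_subset_erase _ hT.1
  · intro T hT
    rw [Finset.mem_powerset] at hT
    exact Finset.erase_insert fun h => Finset.notMem_erase r S (hT h)
  · intro T hT
    exact Finset.insert_erase (Finset.mem_filter.1 hT).2
  · intro T hT
    rw [Finset.mem_powerset] at hT
    rw [Finset.erase_insert fun h => Finset.notMem_erase r S (hT h)]

/-- Each root `r` gives one copy of the coefficient. Splitting off `X` at `r` and convolving over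
subsets of `S.erase r` is a sum over the blocks `T` containing `r`; then the sums over `r` and `T`
are exchanged. -/
theorem card_mul_q (S : Finset V) (i : ℕ) :
    (S.card : ℤ) * q G ∅ S (i + 1) = ∑ T ∈ S.powerset, rootWeight G T * q G ∅ (S \ T) i := by
  have h : ∀ r ∈ S, q G ∅ S (i + 1) = ∑ T ∈ S.powerset,
      if r ∈ T then q G (nbrs G r) (T.erase r) 0 * q G ∅ (S \ T) i else 0 := by
    intro r hr
    rw [q_root_succ G hr (Finset.disjoint_empty_left S), q_eq_sum, sum_powerset_erase hr]
    refine Finset.sum_congr rfl fun T _ => ?_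
    split_ifs with hT
    · congr 2
      ext v
      simp only [Finset.mem_sdiff, Finset.mem_erase]
      by_cases hv : v = r
      · simp [hv, hT]
      · simp [hv]
    · rfl
  rw [← nsmul_eq_mul, ← Finset.sum_const, Finset.sum_congr rfl h, Finset.sum_comm]
  refine Finset.sum_congr rfl fun T hT => ?_
  rw [rootWeight, Finset.sum_mul, ← Finset.sum_filter]
  refine Finset.sum_congr ?_ fun _ _ => rfl
  ext r
  simp only [Finset.mem_filter, and_iff_right_iff_imp]
  exact fun h => Finset.mem_powerset.1 hT h

/-- The excess of the vertex-deleted constant coefficients over the constant coefficient. -/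
noncomputable def excess (N S : Finset V) : ℤ :=
  ∑ u ∈ S, q G N (S.erase u) 0 - q G N S 0

/-- The value of `d` at `1` for `G[T]`. -/
noncomputable def linearDefect (T : Finset V) : ℤ :=
  ∑ u ∈ T, rootWeight G (T.erase u) + (if T.card = 1 then 1 else 0) - rootWeight G T

/-- The factors `n` and `n - 1` are the orders of `G` and `G - u`, exactly what `card_mul_q` needs.
A block of `G - u` is read as a block of `G` with `u` removed, and the terms `a_i(G - u)` are the
singleton blocks. -/
theorem d_eq_sum (i : ℕ) :
    d G (i + 1) = ∑ T : Finset V, linearDefect G T * q G ∅ (Finset.univ \ T) i := by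
  have h1 : ∑ u : V, q G ∅ (Finset.univ.erase u) i =
      ∑ T : Finset V, (if T.card = 1 then 1 else 0) * q G ∅ (Finset.univ \ T) i := by
    simp only [ite_mul, one_mul, zero_mul]
    rw [← Finset.sum_filter]
    refine Finset.sum_bij (fun u _ => {u}) (by simp) (by simp) ?_ ?_
    · intro T hT
      obtain ⟨u, rfl⟩ := Finset.card_eq_one.1 (Finset.mem_filter.1 hT).2
      exact ⟨u, by simp, rfl⟩
    · intro u _
      rw [Finset.sdiff_singleton_eq_erase]
  have h2 : ∑ u : V, ((Nat.card V : ℤ) - 1) * q G ∅ (Finset.univ.erase u) (i + 1) =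
      ∑ T : Finset V, (∑ u ∈ T, rootWeight G (T.erase u)) * q G ∅ (Finset.univ \ T) i := by
    have : ∀ u : V, ((Nat.card V : ℤ) - 1) * q G ∅ (Finset.univ.erase u) (i + 1) =
        ∑ T : Finset V, if u ∈ T then rootWeight G (T.erase u) * q G ∅ (Finset.univ \ T) i
          else 0 := by
      intro u
      have hc : ((Nat.card V : ℤ) - 1) = ((Finset.univ.erase u : Finset V).card : ℤ) := by
        have := Finset.card_erase_add_one (Finset.mem_univ u)
        rw [Finset.card_univ, ← Nat.card_eq_fintype_card] at this
        rw [← this]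
        push_cast
        ring
      rw [hc, card_mul_q, sum_powerset_erase (Finset.mem_univ u), Finset.powerset_univ]
      refine Finset.sum_congr rfl fun T _ => ?_
      split_ifs with hT
      · congr 2
        ext v
        by_cases hv : v = u
        · simp [hv, hT]
        · simp [hv]
      · rfl
    rw [Finset.sum_congr rfl fun u _ => this u, Finset.sum_comm]
    refine Finset.sum_congr rfl fun T _ => ?_
    rw [Finset.sum_mul, ← Finset.sum_filter]
    simp
  have h3 : (Nat.card V : ℤ) * q G ∅ Finset.univ (i + 1) =
      ∑ T : Finset V, rootWeight G T * q G ∅ (Finset.univ \ T) i := by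
    rw [Nat.card_eq_fintype_card, ← Finset.card_univ, card_mul_q, Finset.powerset_univ]
  simp only [d, a_deleteVertex_eq_q, Nat.add_sub_cancel]
  rw [a_eq_q, Finset.sum_add_distrib, h1, h2, h3, ← Finset.sum_add_distrib, ← Finset.sum_sub_distrib]
  refine Finset.sum_congr rfl fun T _ => ?_
  rw [linearDefect]
  ring

theorem linearDefect_eq_zero {T : Finset V} (hT : T.card ≤ 1) : linearDefect G T = 0 := by
  by_cases hV : T = ∅
  · simp [hV, linearDefect, rootWeight]
  · obtain ⟨x, hx⟩ := Finset.card_eq_one.1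
      (le_antisymm hT (Finset.card_pos.2 (Finset.nonempty_iff_ne_empty.2 hV)))
    simp [hx, linearDefect, rootWeight, q_empty]

/-- The deleted vertex and the root form an ordered pair of distinct vertices of `T`, so the two
summations can be exchanged. -/
theorem linearDefect_eq_sum {T : Finset V} (hT : 1 < T.card) :
    linearDefect G T = ∑ r ∈ T, excess G (nbrs G r) (T.erase r) := by
  rw [linearDefect, if_neg hT.ne', add_zero, rootWeight]
  simp only [excess]
  rw [Finset.sum_sub_distrib]
  congr 1
  simp only [rootWeight]
  rw [Finset.sum_sigma', Finset.sum_sigma']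
  refine Finset.sum_bij' (fun p _ => ⟨p.2, p.1⟩) (fun p _ => ⟨p.2, p.1⟩) ?_ ?_ ?_ ?_ ?_
  · rintro ⟨u, r⟩ h
    simp only [Finset.mem_sigma, Finset.mem_erase] at h ⊢
    exact ⟨h.2.2, h.2.1.symm, h.1⟩
  · rintro ⟨u, r⟩ h
    simp only [Finset.mem_sigma, Finset.mem_erase] at h ⊢
    exact ⟨h.2.2, h.2.1.symm, h.1⟩
  · rintro ⟨u, r⟩ _
    rfl
  · rintro ⟨u, r⟩ _
    rfl
  · rintro ⟨u, r⟩ _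
    rw [Finset.erase_right_comm]

/-- `q_step` applies to every summand except `u = v`, and there the marking of `v` is irrelevant. -/
theorem excess_step {N S : Finset V} {v : V} (hN : v ∈ N) (hS : v ∈ S) :
    excess G N S = excess G (N.erase v) S + excess G (N ∪ nbrs G v) (S.erase v) := by
  have h1 : q G N (S.erase v) 0 = q G (N.erase v) (S.erase v) 0 :=
    q_congr G (fun w hw => by simp [Finset.ne_of_mem_erase hw]) 0
  have h2 : ∀ u ∈ S.erase v, q G N (S.erase u) 0 =
      q G (N.erase v) (S.erase u) 0 + q G (N ∪ nbrs G v) ((S.erase v).erase u) 0 := by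
    intro u hu
    rw [q_step G hN (Finset.mem_erase.2 ⟨(Finset.ne_of_mem_erase hu).symm, hS⟩),
      Finset.erase_right_comm]
  rw [excess, excess, excess, q_step G hN hS, ← Finset.add_sum_erase S _ hS,
    ← Finset.add_sum_erase S (fun u => q G (N.erase v) (S.erase u) 0) hS, h1,
    Finset.sum_congr rfl h2, Finset.sum_add_distrib]
  ring

theorem excess_congr {N N' S : Finset V} (h : ∀ v ∈ S, v ∈ N ↔ v ∈ N') :
    excess G N S = excess G N' S := by
  rw [excess, excess, q_congr G h, Finset.sum_congr rfl fun u _ =>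
    q_congr G (fun v hv => h v (Finset.mem_of_mem_erase hv)) 0]

theorem excess_singleton (N : Finset V) (u : V) :
    excess G N {u} = if u ∈ N then 0 else 1 := by
  have h : ∀ N : Finset V, u ∉ N → excess G N {u} = 1 := by
    intro N hu
    rw [excess, q_root_zero G (Finset.singleton_nonempty u) (by simpa using hu)]
    simp [q_empty]
  split_ifs with hu
  · rw [excess_step G hu (Finset.mem_singleton_self u), h _ (Finset.notMem_erase u N)]
    simp [excess, q_empty]
  · exact h N hu

theorem excess_of_disjoint {N S : Finset V} (hN : Disjoint N S) (hS : 1 < S.card) :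
    excess G N S = 0 := by
  rw [excess, q_root_zero G (Finset.card_pos.1 (by lia)) hN, sub_zero]
  refine Finset.sum_eq_zero fun u hu => ?_
  refine q_root_zero G (Finset.card_pos.1 ?_) (hN.mono_right (Finset.erase_subset _ _))
  rw [Finset.card_erase_of_mem hu]
  lia

theorem excess_nonneg {N S : Finset V} (hS : S.Nonempty) : 0 ≤ excess G N S := by
  induction N, S using rooted_induction G with
  | empty N => simp at hS
  | root N S hne hN ih =>
    rw [excess, q_root_zero G hS hN, sub_zero]
    exact Finset.sum_nonneg fun u _ => q_nonneg G _ _ _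
  | step N S v hN hv ih1 ih2 =>
    by_cases h : (S.erase v).Nonempty
    · rw [excess_step G hN hv]
      exact add_nonneg (ih1 hS) (ih2 h)
    -- The recursion must stop at singletons, because the excess of the empty set is `-1`.
    · rw [Finset.not_nonempty_iff_eq_empty, Finset.erase_eq_empty_iff] at h
      rcases h with rfl | rfl
      · simp at hv
      · rw [excess_singleton]
        positivity

theorem linearDefect_nonneg (T : Finset V) : 0 ≤ linearDefect G T := by
  rcases le_or_gt T.card 1 with h | h
  · rw [linearDefect_eq_zero G h]
  · rw [linearDefect_eq_sum G h]
    refine Finset.sum_nonneg fun r hr => excess_nonneg G (Finset.card_pos.1 ?_)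
    rw [Finset.card_erase_of_mem hr]
    lia

theorem d_nonneg (i : ℕ) : 0 ≤ d G (i + 1) := by
  rw [d_eq_sum]
  exact Finset.sum_nonneg fun T _ => mul_nonneg (linearDefect_nonneg G T) (q_nonneg G _ _ _)

theorem d_eq_zero_iff (i : ℕ) : d G (i + 1) = 0 ↔
    ∀ T : Finset V, linearDefect G T = 0 ∨ q G ∅ (Finset.univ \ T) i = 0 := by
  rw [d_eq_sum, Finset.sum_eq_zero_iff_of_nonneg fun T _ =>
    mul_nonneg (linearDefect_nonneg G T) (q_nonneg G _ _ _)]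
  simp only [Finset.mem_univ, true_imp_iff, mul_eq_zero]

end Expansion

/-! ### Connectivity, nonvanishing of coefficients, and sign of the defect -/

section Anchored

variable {V : Type*} [DecidableEq V] (G : SimpleGraph V)

/-- Every connected component of `G[S]` meets `N`, expressed through cuts. -/
def Anchored (N S : Finset V) : Prop :=
  ∀ U ⊆ S, U.Nonempty → ∃ u ∈ U, u ∈ N ∨ ∃ w ∈ S, w ∉ U ∧ G.Adj u w

variable {G}

theorem anchored_empty (N : Finset V) : Anchored G N ∅ := by
  intro U hU hne
  simp [Finset.subset_empty.1 hU] at hne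

theorem anchored_of_subset {N S : Finset V} (h : S ⊆ N) : Anchored G N S :=
  fun _ hU ⟨u, hu⟩ => ⟨u, hu, Or.inl (h (hU hu))⟩

theorem Anchored.mono {N N' S : Finset V} (h : Anchored G N S) (hN : ∀ v ∈ S, v ∈ N → v ∈ N') :
    Anchored G N' S := by
  intro U hU hne
  obtain ⟨u, hu, h⟩ := h U hU hne
  exact ⟨u, hu, h.imp_left (hN u (hU hu))⟩

theorem Anchored.union {N N' S S' : Finset V} (h : Anchored G N S) (h' : Anchored G N' S') :
    Anchored G (N ∪ N') (S ∪ S') := by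
  intro U hU ⟨x, hx⟩
  have aux : ∀ M T : Finset V, Anchored G M T → M ⊆ N ∪ N' → T ⊆ S ∪ S' → x ∈ T →
      ∃ u ∈ U, u ∈ N ∪ N' ∨ ∃ w ∈ S ∪ S', w ∉ U ∧ G.Adj u w := by
    intro M T hMT hM hT hxT
    obtain ⟨u, hu, h⟩ := hMT (U ∩ T) Finset.inter_subset_right ⟨x, Finset.mem_inter.2 ⟨hx, hxT⟩⟩
    refine ⟨u, (Finset.mem_inter.1 hu).1, ?_⟩
    rcases h with h | ⟨w, hw, hwU, hadj⟩
    · exact Or.inl (hM h)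
    · exact Or.inr ⟨w, hT hw, fun h => hwU (Finset.mem_inter.2 ⟨h, hw⟩), hadj⟩
  rcases Finset.mem_union.1 (hU hx) with hxS | hxS
  · exact aux N S h Finset.subset_union_left Finset.subset_union_left hxS
  · exact aux N' S' h' Finset.subset_union_right Finset.subset_union_right hxS

theorem Anchored.insert_adj {N S : Finset V} {x : V} (h : Anchored G N S)
    (hx : ∃ s ∈ S, G.Adj x s) : Anchored G N (insert x S) := by
  intro U hU hne
  by_cases hUS : (U ∩ S).Nonempty
  · obtain ⟨u, hu, h⟩ := h (U ∩ S) Finset.inter_subset_right hUS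
    refine ⟨u, (Finset.mem_inter.1 hu).1, h.imp_right ?_⟩
    rintro ⟨w, hw, hwU, hadj⟩
    exact ⟨w, Finset.mem_insert_of_mem hw, fun h => hwU (Finset.mem_inter.2 ⟨h, hw⟩), hadj⟩
  · rw [Finset.not_nonempty_iff_eq_empty, ← Finset.disjoint_iff_inter_eq_empty,
      Finset.disjoint_left] at hUS
    obtain ⟨u, hu⟩ := hne
    obtain ⟨s, hs, hadj⟩ := hx
    have : u = x := (Finset.mem_insert.1 (hU hu)).resolve_right (hUS hu)
    subst this
    exact ⟨u, hu, Or.inr ⟨s, Finset.mem_insert_of_mem hs, fun h => hUS h hs, hadj⟩⟩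

theorem Anchored.insert_mem {N S : Finset V} {x : V} (h : Anchored G N S) (hx : x ∈ N) :
    Anchored G N (insert x S) := by
  rw [Finset.insert_eq, Finset.union_comm]
  simpa using h.union (N' := N) (S' := {x}) (anchored_of_subset (by simpa using hx))

/-- This plays the role of removing a leaf of a spanning forest rooted in `N`. Take a largest proper
anchored subset containing `S ∩ N`; some outside vertex is adjacent to it, and adding that vertex
must give all of `S`. -/
theorem Anchored.exists_erase {N S : Finset V} (h : Anchored G N S) (hS : ¬ S ⊆ N) :
    ∃ x ∈ S, x ∉ N ∧ Anchored G N (S.erase x) := by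
  classical
  obtain ⟨C, hC, hmax⟩ := (S.powerset.filter fun C => S ∩ N ⊆ C ∧ C ≠ S ∧
    ∀ U ⊆ C, U.Nonempty → ∃ u ∈ U, u ∈ N ∨ ∃ w ∈ C, w ∉ U ∧ G.Adj u w).exists_max_image
      Finset.card ⟨S ∩ N, by
        simp only [Finset.mem_filter, Finset.mem_powerset]
        exact ⟨Finset.inter_subset_left, subset_rfl,
          fun h => hS (Finset.inter_eq_left.1 h), anchored_of_subset Finset.inter_subset_right⟩⟩
  simp only [Finset.mem_filter, Finset.mem_powerset] at hC hmax
  obtain ⟨hCS, hNC, hne, hanc⟩ := hC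
  have hU : (S \ C).Nonempty := Finset.sdiff_nonempty.2 fun h => hne (hCS.antisymm h)
  obtain ⟨u, hu, h'⟩ := h (S \ C) Finset.sdiff_subset hU
  rw [Finset.mem_sdiff] at hu
  have huN : u ∉ N := fun h => hu.2 (hNC (Finset.mem_inter.2 ⟨hu.1, h⟩))
  obtain ⟨w, hw, hwU, hadj⟩ := h'.resolve_left huN
  have hwC : w ∈ C := by
    by_contra h
    exact hwU (Finset.mem_sdiff.2 ⟨hw, h⟩)
  have hins : Anchored G N (insert u C) := Anchored.insert_adj hanc ⟨w, hwC, hadj⟩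
  by_cases hI : insert u C = S
  · refine ⟨u, hu.1, huN, ?_⟩
    rw [← hI, Finset.erase_insert hu.2]
    exact hanc
  · have := hmax (insert u C) ⟨Finset.insert_subset hu.1 hCS,
      hNC.trans (Finset.subset_insert _ _), hI, hins⟩
    rw [Finset.card_insert_of_notMem hu.2] at this
    lia

theorem Anchored.exists_erase_of_nonempty {N S : Finset V} (h : Anchored G N S)
    (hS : S.Nonempty) : ∃ x ∈ S, Anchored G N (S.erase x) := by
  by_cases hN : S ⊆ N
  · obtain ⟨x, hx⟩ := hS
    exact ⟨x, hx, anchored_of_subset ((Finset.erase_subset _ _).trans hN)⟩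
  · obtain ⟨x, hx, _, h⟩ := h.exists_erase hN
    exact ⟨x, hx, h⟩

/-- Being anchored at a single vertex of `S` is connectedness. For a cut with the old root inside
and the new one outside, the crossing edge comes from the complementary cut. -/
theorem Anchored.reroot {S : Finset V} {r r' : V} (h : Anchored G {r} S) (hr : r' ∈ S) :
    Anchored G {r'} S := by
  intro U hU hne
  by_cases hr' : r' ∈ U
  · exact ⟨r', hr', Or.inl (Finset.mem_singleton_self _)⟩
  · by_cases hrU : r ∈ U
    · obtain ⟨u, hu, h'⟩ := h (S \ U) Finset.sdiff_subset ⟨r', Finset.mem_sdiff.2 ⟨hr, hr'⟩⟩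
      rw [Finset.mem_sdiff] at hu
      obtain ⟨w, hw, hwU, hadj⟩ := h'.resolve_left fun h =>
        hu.2 (Finset.mem_singleton.1 h ▸ hrU)
      refine ⟨w, ?_, Or.inr ⟨u, hu.1, hu.2, hadj.symm⟩⟩
      by_contra h
      exact hwU (Finset.mem_sdiff.2 ⟨hw, h⟩)
    · obtain ⟨u, hu, h'⟩ := h U hU hne
      exact ⟨u, hu, Or.inr (h'.resolve_left fun h => hrU (Finset.mem_singleton.1 h ▸ hu))⟩

variable [Fintype V]

theorem anchored_step {N S : Finset V} {v : V} (hN : v ∈ N) (hS : v ∈ S) :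
    Anchored G N S ↔ Anchored G (N ∪ nbrs G v) (S.erase v) := by
  constructor
  · intro h U hU hne
    obtain ⟨u, hu, h' | ⟨w, hw, hwU, hadj⟩⟩ := h U (hU.trans (Finset.erase_subset _ _)) hne
    · exact ⟨u, hu, Or.inl (Finset.mem_union_left _ h')⟩
    · refine ⟨u, hu, ?_⟩
      by_cases hwv : w = v
      · subst hwv
        exact Or.inl (Finset.mem_union_right _ ((mem_nbrs G).2 hadj.symm))
      · exact Or.inr ⟨w, Finset.mem_erase.2 ⟨hwv, hw⟩, hwU, hadj⟩
  · intro h U hU hne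
    by_cases hv : v ∈ U
    · exact ⟨v, hv, Or.inl hN⟩
    · obtain ⟨u, hu, h' | ⟨w, hw, hwU, hadj⟩⟩ := h U (Finset.subset_erase.2 ⟨hU, hv⟩) hne
      · rcases Finset.mem_union.1 h' with h' | h'
        · exact ⟨u, hu, Or.inl h'⟩
        · exact ⟨u, hu, Or.inr ⟨v, hS, hv, ((mem_nbrs G).1 h').symm⟩⟩
      · exact ⟨u, hu, Or.inr ⟨w, Finset.mem_of_mem_erase hw, hwU, hadj⟩⟩

/-- Each factor `X` split off contributes one new root, and `j` of them are collected in `M`.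
`q_pos` is the converse. -/
theorem exists_anchored_of_q_ne_zero {N S : Finset V} {j : ℕ} (h : q G N S j ≠ 0) :
    ∃ M ⊆ S, M.card = j ∧ Anchored G (N ∪ M) S := by
  induction N, S using rooted_induction G generalizing j with
  | empty N =>
    rw [q_empty] at h
    exact ⟨∅, subset_rfl, by simpa [eq_comm] using h, anchored_empty _⟩
  | root N S hne hN ih =>
    cases j with
    | zero => exact absurd (q_root_zero G hne hN) h
    | succ j =>
      obtain ⟨r, hr⟩ := hne
      rw [q_root_succ G hr hN] at h
      obtain ⟨M, hMS, hM, hanc⟩ := ih r hr h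
      have hrM : r ∉ M := fun h => Finset.notMem_erase r S (hMS h)
      refine ⟨insert r M, Finset.insert_subset hr (hMS.trans (Finset.erase_subset _ _)),
        by rw [Finset.card_insert_of_notMem hrM, hM], ?_⟩
      rw [anchored_step (v := r) (by simp) hr]
      exact hanc.mono fun v _ hv => by
        simp only [Finset.mem_union, Finset.mem_insert] at hv ⊢
        tauto
  | step N S v hN hS ih1 ih2 =>
    rw [q_step G hN hS] at h
    by_cases h1 : q G (N.erase v) S j = 0
    · rw [h1, zero_add] at h
      obtain ⟨M, hMS, hM, hanc⟩ := ih2 h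
      refine ⟨M, hMS.trans (Finset.erase_subset _ _), hM, ?_⟩
      rw [anchored_step (v := v) (by simp [hN]) hS]
      exact hanc.mono fun w _ hw => by
        simp only [Finset.mem_union] at hw ⊢
        tauto
    · obtain ⟨M, hMS, hM, hanc⟩ := ih1 h1
      exact ⟨M, hMS, hM, hanc.mono fun w _ hw => by
        simp only [Finset.mem_union, Finset.mem_erase] at hw ⊢
        tauto⟩

theorem q_pos {N S M : Finset V} (hM : M ⊆ S) (h : Anchored G (N ∪ M) S) :
    0 < q G N S M.card := by
  induction N, S using rooted_induction G generalizing M with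
  | empty N => simp [q_empty, Finset.subset_empty.1 hM]
  | root N S hne hN ih =>
    obtain ⟨u, hu, h' | ⟨w, hw, hwS, _⟩⟩ := h S subset_rfl hne
    · have huM : u ∈ M := (Finset.mem_union.1 h').resolve_left
        fun h => Finset.disjoint_left.1 hN h hu
      rw [← Finset.card_erase_add_one huM, q_root_succ G hu hN]
      refine ih u hu (Finset.erase_subset_erase _ hM) ?_
      rw [anchored_step (v := u) h' hu] at h
      refine h.mono fun w hw hwN => ?_
      have h1 : w ∉ N := fun h => Finset.disjoint_left.1 hN h (Finset.mem_of_mem_erase hw)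
      have h2 := Finset.ne_of_mem_erase hw
      simp only [Finset.mem_union, Finset.mem_erase] at hwN ⊢
      tauto
    · exact absurd hw hwS
  | step N S v hN hS ih1 ih2 =>
    rw [q_step G hN hS]
    by_cases hv : v ∈ M
    · refine add_pos_of_pos_of_nonneg (ih1 hM (h.mono fun w _ hw => ?_)) (q_nonneg G _ _ _)
      simp only [Finset.mem_union, Finset.mem_erase] at hw ⊢
      by_cases hwv : w = v
      · exact Or.inr (hwv ▸ hv)
      · tauto
    · refine add_pos_of_nonneg_of_pos (q_nonneg G _ _ _) (ih2 (Finset.subset_erase.2 ⟨hM, hv⟩) ?_)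
      rw [anchored_step (v := v) (by simp [hN]) hS] at h
      exact h.mono fun w _ hw => by
        simp only [Finset.mem_union] at hw ⊢
        tauto

/-- Anchoring always provides a marked vertex of `Y` to delete. In each use of `excess_step` the
branch that unmarks it is nonnegative and dropped; the other marks its neighbors. -/
theorem excess_le_excess {Y X N N' : Finset V} (hX : X.Nonempty) (hYX : Disjoint Y X)
    (h : Anchored G N Y) (hN' : ∀ v ∈ X, v ∈ N' ↔ v ∈ N ∨ ∃ w ∈ Y, G.Adj w v) :
    excess G N' X ≤ excess G N (Y ∪ X) := by
  induction hc : Y.card generalizing Y N with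
  | zero =>
    rw [Finset.card_eq_zero.1 hc, Finset.empty_union]
    refine (excess_congr G fun v hv => ?_).le
    rw [hN' v hv, Finset.card_eq_zero.1 hc]
    simp
  | succ m ih =>
    obtain ⟨v, hv, h' | ⟨w, hw, hwY, _⟩⟩ :=
      h Y subset_rfl (Finset.card_pos.1 (by rw [hc]; exact m.succ_pos))
    · have hvX : v ∉ X := Finset.disjoint_left.1 hYX hv
      rw [excess_step G h' (Finset.mem_union_left _ hv), Finset.erase_union_distrib,
        Finset.erase_eq_of_notMem hvX]
      refine le_add_of_nonneg_of_le (excess_nonneg G (hX.mono Finset.subset_union_right)) ?_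
      refine ih (hYX.mono_left (Finset.erase_subset _ _)) ((anchored_step h' hv).1 h) ?_
        (by rw [Finset.card_erase_of_mem hv, hc]; rfl)
      intro x hx
      rw [hN' x hx]
      simp only [Finset.mem_union, Finset.mem_erase, mem_nbrs]
      constructor
      · rintro (h | ⟨w, hw, hadj⟩)
        · exact Or.inl (Or.inl h)
        · by_cases hwv : w = v
          · exact Or.inl (Or.inr (hwv ▸ hadj))
          · exact Or.inr ⟨w, ⟨hwv, hw⟩, hadj⟩
      · rintro ((h | h) | ⟨w, hw, hadj⟩)
        · exact Or.inl h
        · exact Or.inr ⟨v, hv, h⟩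
        · exact Or.inr ⟨w, hw.2, hadj⟩
    · exact absurd hw hwY

theorem excess_le_linearDefect {C X N' : Finset V} {r : V} (hr : r ∈ C) (hC : Anchored G {r} C)
    (hX : X.Nonempty) (hCX : Disjoint C X) (hN' : ∀ v ∈ X, v ∈ N' ↔ ∃ w ∈ C, G.Adj w v) :
    excess G N' X ≤ linearDefect G (C ∪ X) := by
  have hcard : 1 < (C ∪ X).card := by
    have := Finset.card_pos.2 hX
    have := Finset.card_pos.2 ⟨r, hr⟩
    rw [Finset.card_union_of_disjoint hCX]
    lia
  rw [linearDefect_eq_sum G hcard]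
  refine le_trans ?_ (Finset.single_le_sum (f := fun r => excess G (nbrs G r) ((C ∪ X).erase r))
    (fun s hs => excess_nonneg G (Finset.card_pos.1 ?_)) (Finset.mem_union_left X hr))
  · rw [Finset.erase_union_distrib, Finset.erase_eq_of_notMem (Finset.disjoint_left.1 hCX hr)]
    refine excess_le_excess hX (hCX.mono_left (Finset.erase_subset _ _)) ?_ fun v hv => ?_
    · refine ((anchored_step (Finset.mem_singleton_self r) hr).1 hC).mono fun v hv h => ?_
      simpa [Finset.ne_of_mem_erase hv] using h
    · rw [hN' v hv, mem_nbrs]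
      constructor
      · rintro ⟨w, hw, hadj⟩
        by_cases hwr : w = r
        · exact Or.inl (hwr ▸ hadj)
        · exact Or.inr ⟨w, Finset.mem_erase.2 ⟨hwr, hw⟩, hadj⟩
      · rintro (h | ⟨w, hw, hadj⟩)
        · exact ⟨r, hr, h⟩
        · exact ⟨w, Finset.mem_of_mem_erase hw, hadj⟩
  · rw [Finset.card_erase_of_mem hs]
    lia

theorem linearDefect_pos_of_isolated {C : Finset V} {r x : V} (hr : r ∈ C)
    (hC : Anchored G {r} C) (hx : x ∉ C) (h : ∀ w ∈ C, ¬ G.Adj w x) :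
    0 < linearDefect G (C ∪ {x}) := by
  refine lt_of_lt_of_le ?_ (excess_le_linearDefect (N' := ∅) hr hC (Finset.singleton_nonempty x)
    (by simpa using hx) (by simpa using h))
  simp [excess_singleton]

/-- Absorbing `C` leaves `{x, y}` with both vertices marked. Its excess is `1`: unmarking `x` and
then deleting `y` leaves `x` unmarked precisely because `x` and `y` are nonadjacent. -/
theorem linearDefect_pos_of_pair {C : Finset V} {r x y : V} (hr : r ∈ C)
    (hC : Anchored G {r} C) (hx : x ∉ C) (hy : y ∉ C) (hxy : x ≠ y) (hadj : ¬ G.Adj x y)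
    (hxC : ∃ w ∈ C, G.Adj w x) (hyC : ∃ w ∈ C, G.Adj w y) :
    0 < linearDefect G (C ∪ {x, y}) := by
  refine lt_of_lt_of_le ?_ (excess_le_linearDefect (N' := {x, y}) hr hC
    (Finset.insert_nonempty x {y}) (by simp [hx, hy]) ?_)
  · rw [excess_step G (v := x) (by simp) (by simp),
      excess_step G (v := y) (by simp [hxy.symm]) (by simp)]
    have h1 : ({x, y} : Finset V).erase x = {y} := by
      ext v
      simp only [Finset.mem_erase, Finset.mem_insert, Finset.mem_singleton]
      constructor
      · tauto
      · rintro rfl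
        exact ⟨hxy.symm, Or.inr rfl⟩
    have h2 : ({x, y} : Finset V).erase y = {x} := by
      ext v
      simp only [Finset.mem_erase, Finset.mem_insert, Finset.mem_singleton]
      constructor
      · tauto
      · rintro rfl
        exact ⟨hxy, Or.inl rfl⟩
    rw [h1, h2, excess_of_disjoint G (by simp) (by rw [Finset.card_pair hxy]; lia),
      excess_singleton, excess_singleton, if_neg, if_pos (by simp)]
    · norm_num
    · simp [mem_nbrs, hxy, G.adj_comm y x, hadj]
  · intro v hv
    rcases Finset.mem_insert.1 hv with rfl | hv
    · simpa using hxC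
    · rw [Finset.mem_singleton.1 hv]
      simpa using hyC

theorem exists_anchored_of_linearDefect_ne_zero {T : Finset V} (h : linearDefect G T ≠ 0) :
    ∃ u ∈ T, ∃ r ∈ T.erase u, Anchored G {r} (T.erase u) := by
  have hT : 1 < T.card := by
    by_contra hT
    exact h (linearDefect_eq_zero G (by lia))
  rw [linearDefect_eq_sum G hT] at h
  obtain ⟨r, hr, h⟩ := Finset.exists_ne_zero_of_sum_ne_zero h
  have hne : (T.erase r).Nonempty := Finset.card_pos.1 (by
    rw [Finset.card_erase_of_mem hr]
    lia)
  -- Were the sum zero, the excess would be minus a nonnegative number, while itself nonnegative,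
  -- hence zero.
  have : ∑ u ∈ T.erase r, q G (nbrs G r) ((T.erase r).erase u) 0 ≠ 0 := by
    intro h0
    have h1 := excess_nonneg G (N := nbrs G r) hne
    have h2 := q_nonneg G (nbrs G r) (T.erase r) 0
    rw [excess] at h h1
    exact h (le_antisymm (by lia) h1)
  obtain ⟨u, hu, h⟩ := Finset.exists_ne_zero_of_sum_ne_zero this
  obtain ⟨M, -, hM, hanc⟩ := exists_anchored_of_q_ne_zero h
  rw [Finset.card_eq_zero.1 hM, Finset.union_empty, Finset.erase_right_comm] at hanc
  have hru : r ∈ T.erase u := Finset.mem_erase.2 ⟨(Finset.ne_of_mem_erase hu).symm, hr⟩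
  refine ⟨u, Finset.mem_of_mem_erase hu, r, hru, ?_⟩
  rw [anchored_step (Finset.mem_singleton_self r) hru]
  exact hanc.mono fun v _ hv => Finset.mem_union_right _ hv

/-- Unmarking the end gives excess zero on at least two vertices; deleting it marks the next vertex,
the end of a shorter path. -/
theorem excess_path_end {p : ℕ → V} {m : ℕ} (hinj : ∀ i ≤ m, ∀ j ≤ m, p i = p j → i = j)
    (hadj : ∀ i ≤ m, ∀ j ≤ m, G.Adj (p i) (p j) ↔ i + 1 = j ∨ j + 1 = i) :
    excess G {p m} ((Finset.range (m + 1)).image p) = 0 := by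
  induction m with
  | zero => simp [excess_singleton]
  | succ m ih =>
    have hmem : ∀ i ≤ m + 1, p i ∈ (Finset.range (m + 2)).image p := fun i hi =>
      Finset.mem_image_of_mem p (Finset.mem_range.2 (by lia))
    have herase : ((Finset.range (m + 2)).image p).erase (p (m + 1)) =
        (Finset.range (m + 1)).image p := by
      rw [Finset.range_add_one, Finset.image_insert, Finset.erase_insert]
      simp only [Finset.mem_image, Finset.mem_range, not_exists, not_and]
      intro i hi h
      have := hinj i (by lia) (m + 1) le_rfl h
      lia
    rw [excess_step G (Finset.mem_singleton_self _) (hmem _ le_rfl), herase,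
      excess_of_disjoint G (by simp), zero_add,
      ← ih (fun i hi j hj => hinj i (by lia) j (by lia)) fun i hi j hj =>
        hadj i (by lia) j (by lia)]
    · refine excess_congr G fun v hv => ?_
      obtain ⟨i, hi, rfl⟩ := Finset.mem_image.1 hv
      rw [Finset.mem_range] at hi
      have h1 : p i = p m ↔ i = m := ⟨hinj i (by lia) m (by lia), fun h => h ▸ rfl⟩
      have h2 : ¬ p i = p (m + 1) := fun h => by
        have := hinj i (by lia) (m + 1) (by lia) h
        lia
      simp only [Finset.mem_union, Finset.mem_singleton, mem_nbrs, h1, h2, false_or,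
        hadj (m + 1) le_rfl i (by lia)]
      lia
    · refine Finset.one_lt_card.2 ⟨_, hmem 0 (by lia), _, hmem (m + 1) le_rfl, fun h => ?_⟩
      have := hinj 0 (by lia) (m + 1) le_rfl h
      lia

theorem excess_path_ends {p : ℕ → V} {m : ℕ} (hinj : ∀ i ≤ m, ∀ j ≤ m, p i = p j → i = j)
    (hadj : ∀ i ≤ m, ∀ j ≤ m, G.Adj (p i) (p j) ↔ i + 1 = j ∨ j + 1 = i) :
    excess G {p 0, p m} ((Finset.range (m + 1)).image p) = 0 := by
  induction m with
  | zero => simp [excess_singleton]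
  | succ m ih =>
    have herase : ((Finset.range (m + 2)).image p).erase (p (m + 1)) =
        (Finset.range (m + 1)).image p := by
      rw [Finset.range_add_one, Finset.image_insert, Finset.erase_insert]
      simp only [Finset.mem_image, Finset.mem_range, not_exists, not_and]
      intro i hi h
      have := hinj i (by lia) (m + 1) le_rfl h
      lia
    have h0 : ¬ p 0 = p (m + 1) := fun h => by
      have := hinj 0 (by lia) (m + 1) le_rfl h
      lia
    -- Unmarking `p (m + 1)` leaves only `p 0` marked, which is the last vertex of the reversed
    -- path.
    have hrev := excess_path_end (G := G) (p := fun i => p (m + 1 - i)) (m := m + 1)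
      (fun i hi j hj h => by
        have := hinj _ (by lia) _ (by lia) h
        lia)
      (fun i hi j hj => by
        rw [hadj _ (by lia) _ (by lia)]
        lia)
    have himg : (Finset.range (m + 2)).image (fun i => p (m + 1 - i)) =
        (Finset.range (m + 2)).image p := by
      ext v
      simp only [Finset.mem_image, Finset.mem_range]
      constructor
      · rintro ⟨i, hi, rfl⟩
        exact ⟨m + 1 - i, by lia, rfl⟩
      · rintro ⟨i, hi, rfl⟩
        exact ⟨m + 1 - i, by lia, by rw [show m + 1 - (m + 1 - i) = i by lia]⟩
    rw [himg, Nat.sub_self] at hrev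
    rw [excess_step G (v := p (m + 1)) (by simp)
      (Finset.mem_image_of_mem p (Finset.mem_range.2 (by lia))), herase]
    have h1 : excess G (({p 0, p (m + 1)} : Finset V).erase (p (m + 1)))
        ((Finset.range (m + 2)).image p) = 0 := by
      rw [← hrev]
      refine excess_congr G fun v _ => ?_
      simp only [Finset.mem_erase, Finset.mem_insert, Finset.mem_singleton]
      constructor
      · tauto
      · rintro rfl
        exact ⟨h0, Or.inl rfl⟩
    rw [h1, zero_add, ← ih (fun i hi j hj => hinj i (by lia) j (by lia)) fun i hi j hj =>
      hadj i (by lia) j (by lia)]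
    refine excess_congr G fun v hv => ?_
    obtain ⟨i, hi, rfl⟩ := Finset.mem_image.1 hv
    rw [Finset.mem_range] at hi
    have h1 : p i = p m ↔ i = m := ⟨hinj i (by lia) m (by lia), fun h => h ▸ rfl⟩
    have h2 : ¬ p i = p (m + 1) := fun h => by
      have := hinj i (by lia) (m + 1) (by lia) h
      lia
    simp only [Finset.mem_union, Finset.mem_insert, Finset.mem_singleton, mem_nbrs, h1, h2,
      or_false, hadj (m + 1) le_rfl i (by lia)]
    have : m + 1 + 1 = i ∨ i + 1 = m + 1 ↔ i = m := by lia
    rw [this]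

end Anchored

/-! ### Characterizing cycles by nonadjacent pairs; the defect of a cycle -/

section Cycle

variable {V : Type*} [Fintype V] [DecidableEq V] {G : SimpleGraph V}

/-- The cut vertex `y` separates `S.erase y` into two sides without edges between them. Each side
together with `y` is connected, so one vertex other than `y` can be peeled off each side, and the
remainders are glued at `y`. -/
theorem exists_nonadjacent_pair_of_cut {S : Finset V} {y z : V} (hS : Anchored G {y} S)
    (hz : z ∈ S.erase y) (hcut : ¬ Anchored G {z} (S.erase y)) :
    ∃ x₁ ∈ S.erase y, ∃ x₂ ∈ S.erase y, x₁ ≠ x₂ ∧ ¬ G.Adj x₁ x₂ ∧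
      Anchored G {y} ((S.erase x₁).erase x₂) := by
  simp only [Anchored, not_forall, not_exists, not_and, not_or] at hcut
  obtain ⟨U, hU, ⟨u₀, hu₀⟩, hcut⟩ := hcut
  have closed : ∀ A ⊆ S.erase y, (∀ u ∈ A, ∀ w ∈ S.erase y, w ∉ A → ¬ G.Adj u w) →
      Anchored G {y} (insert y A) := by
    intro A hA hclosed W hW hne
    by_cases hy : y ∈ W
    · exact ⟨y, hy, Or.inl (Finset.mem_singleton_self y)⟩
    · have hWA : W ⊆ A := fun w hw =>
        (Finset.mem_insert.1 (hW hw)).resolve_left fun h => hy (h ▸ hw)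
      obtain ⟨u, hu, h | ⟨w, hw, hwW, hadj⟩⟩ :=
        hS W ((hWA.trans hA).trans (Finset.erase_subset _ _)) hne
      · exact absurd (Finset.mem_singleton.1 h ▸ hu) hy
      · refine ⟨u, hu, Or.inr ⟨w, ?_, hwW, hadj⟩⟩
        by_contra hwA
        rw [Finset.mem_insert, not_or] at hwA
        exact hclosed u (hWA hu) w (Finset.mem_erase.2 ⟨hwA.1, hw⟩) hwA.2 hadj
  have peel : ∀ A ⊆ S.erase y, A.Nonempty →
      (∀ u ∈ A, ∀ w ∈ S.erase y, w ∉ A → ¬ G.Adj u w) →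
      ∃ x ∈ A, Anchored G {y} (insert y (A.erase x)) := by
    intro A hA ⟨a, ha⟩ hclosed
    have hya : y ∉ A := fun h => Finset.notMem_erase y S (hA h)
    obtain ⟨x, hx, hxy, hanc⟩ := (closed A hA hclosed).exists_erase fun h =>
      hya (Finset.mem_singleton.1 (h (Finset.mem_insert_of_mem ha)) ▸ ha)
    rw [Finset.mem_singleton] at hxy
    refine ⟨x, (Finset.mem_insert.1 hx).resolve_left hxy, ?_⟩
    rwa [Finset.erase_insert_of_ne fun h => hxy h.symm] at hanc
  have hzU : z ∉ U := fun h => (hcut z h).1 (Finset.mem_singleton_self z)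
  obtain ⟨x₁, hx₁, h₁⟩ := peel U hU ⟨u₀, hu₀⟩
    fun u hu w hw hwU hadj => (hcut u hu).2 w hw hwU hadj
  obtain ⟨x₂, hx₂, h₂⟩ := peel (S.erase y \ U) Finset.sdiff_subset
    ⟨z, Finset.mem_sdiff.2 ⟨hz, hzU⟩⟩ fun u hu w hw hwU hadj => by
      have hwU' : w ∈ U := by
        by_contra h
        exact hwU (Finset.mem_sdiff.2 ⟨hw, h⟩)
      exact (hcut w hwU').2 u (Finset.mem_sdiff.1 hu).1 (Finset.mem_sdiff.1 hu).2 hadj.symm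
  rw [Finset.mem_sdiff] at hx₂
  refine ⟨x₁, hU hx₁, x₂, hx₂.1, fun h => hx₂.2 (h ▸ hx₁),
    (hcut x₁ hx₁).2 x₂ hx₂.1 hx₂.2, ?_⟩
  have hyS : y ∈ S := by
    obtain ⟨u, hu, h | ⟨w, hw, hwS, _⟩⟩ := hS S subset_rfl ⟨z, Finset.mem_of_mem_erase hz⟩
    · exact Finset.mem_singleton.1 h ▸ hu
    · exact absurd hw hwS
  have := h₁.union h₂
  rw [Finset.union_self] at this
  convert this using 1
  ext v
  have h3 := Finset.mem_erase.1 (hU hx₁)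
  have h4 := Finset.mem_erase.1 hx₂.1
  have h5 : v ∈ U → v ≠ y ∧ v ∈ S := fun h => Finset.mem_erase.1 (hU h)
  simp only [Finset.mem_erase, Finset.mem_union, Finset.mem_insert, Finset.mem_sdiff]
  by_cases h6 : v = y
  · subst h6
    simp [hyS, h3.1.symm, h4.1.symm]
  · by_cases h7 : v = x₁
    · subst h7
      simp [hx₁, h6]
    · by_cases h8 : v = x₂
      · subst h8
        simp [hx₂.2, h6]
      · simp only [ne_eq, h6, h7, h8, not_false_eq_true, true_and, false_or]
        tauto

theorem anchored_erase_of_no_pair (hconn : ∀ r, Anchored G {r} Finset.univ)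
    (hpair : ∀ x y, x ≠ y → ¬ G.Adj x y → ∀ r ∈ (Finset.univ.erase x).erase y,
      ¬ Anchored G {r} ((Finset.univ.erase x).erase y)) {v z : V} (hzv : z ≠ v) :
    Anchored G {z} (Finset.univ.erase v) := by
  by_contra h
  obtain ⟨x₁, hx₁, x₂, hx₂, hne, hadj, hanc⟩ :=
    exists_nonadjacent_pair_of_cut (hconn v) (Finset.mem_erase.2 ⟨hzv, Finset.mem_univ z⟩) h
  refine hpair x₁ x₂ hne hadj v ?_ hanc
  simp [(Finset.ne_of_mem_erase hx₁).symm, (Finset.ne_of_mem_erase hx₂).symm]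

/-- A vertex adjacent to all others would keep `G - x - y` connected for any nonadjacent `x`, `y`,
and such a pair exists as `G` is not complete. -/
theorem exists_not_adj_of_no_pair (hG : G ≠ ⊤)
    (hpair : ∀ x y, x ≠ y → ¬ G.Adj x y → ∀ r ∈ (Finset.univ.erase x).erase y,
      ¬ Anchored G {r} ((Finset.univ.erase x).erase y)) (v : V) :
    ∃ y, y ≠ v ∧ ¬ G.Adj v y := by
  by_contra! h
  refine hG (top_le_iff.1 fun x y hxy => ?_)
  rw [SimpleGraph.top_adj] at hxy
  by_contra hadj
  have hx : v ≠ x := by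
    rintro rfl
    exact hadj (h y hxy.symm)
  have hy : v ≠ y := by
    rintro rfl
    exact hadj (h x hxy).symm
  refine hpair x y hxy hadj v (by simp [hx, hy]) ?_
  intro U hU ⟨u, hu⟩
  by_cases hv : v ∈ U
  · exact ⟨v, hv, Or.inl (Finset.mem_singleton_self v)⟩
  · exact ⟨u, hu, Or.inr ⟨v, by simp [hx, hy], hv, (h u fun h => hv (h ▸ hu)).symm⟩⟩

theorem card_nbrs_of_no_pair (hG : G ≠ ⊤) (hconn : ∀ r, Anchored G {r} Finset.univ)
    (hpair : ∀ x y, x ≠ y → ¬ G.Adj x y → ∀ r ∈ (Finset.univ.erase x).erase y,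
      ¬ Anchored G {r} ((Finset.univ.erase x).erase y)) (v : V) :
    (nbrs G v).card = 2 := by
  obtain ⟨y, hyv, hvy⟩ := exists_not_adj_of_no_pair hG hpair v
  have hyS : y ∈ (Finset.univ.erase v : Finset V) := Finset.mem_erase.2 ⟨hyv, Finset.mem_univ y⟩
  refine le_antisymm ?_ ?_
  · obtain ⟨z, hz⟩ : ((Finset.univ.erase v).erase y : Finset V).Nonempty := by
      by_contra h
      rw [Finset.not_nonempty_iff_eq_empty] at h
      obtain ⟨u, hu, h' | ⟨w, -, hw, hadj⟩⟩ :=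
        hconn y {v} (Finset.subset_univ _) (Finset.singleton_nonempty v)
      · rw [Finset.mem_singleton] at hu h'
        exact hyv (h' ▸ hu)
      · rw [Finset.mem_singleton] at hu hw
        subst hu
        have : w ∈ (Finset.univ.erase u).erase y := by
          simp only [Finset.mem_erase, Finset.mem_univ, and_true]
          exact ⟨fun h => hvy (h ▸ hadj), hw⟩
        simp [h] at this
    -- Since `v` and `y` are nonadjacent, `y` cuts `G - v`. A neighbor of `v` other than `x₁`, `x₂`
    -- would attach `v` to the connected remainder, making `x₁`, `x₂` a forbidden pair.
    obtain ⟨x₁, hx₁, x₂, hx₂, hne, hadj, hanc⟩ := exists_nonadjacent_pair_of_cut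
      (anchored_erase_of_no_pair hconn hpair hyv) hz (hpair v y hyv.symm hvy z hz)
    have hsub : nbrs G v ⊆ {x₁, x₂} := by
      intro w hw
      rw [mem_nbrs] at hw
      by_contra hwx
      simp only [Finset.mem_insert, Finset.mem_singleton, not_or] at hwx
      have h1 : v ≠ x₁ := by
        rintro rfl
        simp at hx₁
      have h2 : v ≠ x₂ := by
        rintro rfl
        simp at hx₂
      refine hpair x₁ x₂ hne hadj y ?_ ?_
      · simp [(Finset.ne_of_mem_erase hx₁).symm, (Finset.ne_of_mem_erase hx₂).symm]
      · have := hanc.insert_adj (x := v) ⟨w, by simp [hwx, hw.ne'], hw⟩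
        convert this using 1
        ext u
        by_cases huv : u = v
        · simp [huv, h1, h2]
        · simp [huv]
    exact (Finset.card_le_card hsub).trans Finset.card_le_two
  -- `G - w` is still connected and contains both `v` and `y`, so `v` has a neighbor besides `w`.
  · have step : ∀ w, w ≠ y → w ≠ v → ∃ w' ≠ w, G.Adj v w' := by
      intro w hwy hwv
      obtain ⟨u, hu, h | ⟨w', hw', _, hadj⟩⟩ :=
        anchored_erase_of_no_pair hconn hpair hwy.symm (v := w) {v} (by simp [hwv.symm])
          (Finset.singleton_nonempty v)
      · rw [Finset.mem_singleton] at hu h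
        exact absurd (h.symm.trans hu) hyv
      · rw [Finset.mem_singleton] at hu
        exact ⟨w', Finset.ne_of_mem_erase hw', hu ▸ hadj⟩
    obtain ⟨w, hvw⟩ : ∃ w, G.Adj v w := by
      obtain ⟨u, hu, h | ⟨w, -, -, hadj⟩⟩ :=
        hconn y {v} (Finset.subset_univ _) (Finset.singleton_nonempty v)
      · rw [Finset.mem_singleton] at hu h
        exact absurd (h.symm.trans hu) hyv
      · rw [Finset.mem_singleton] at hu
        exact ⟨w, hu ▸ hadj⟩
    obtain ⟨w', hne, hvw'⟩ := step w (fun h => hvy (h ▸ hvw)) hvw.ne'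
    exact Finset.one_lt_card.2 ⟨w, (mem_nbrs G).2 hvw, w', (mem_nbrs G).2 hvw', hne.symm⟩

theorem nonempty_iso_cycleGraph (hG : G.Connected) (h2 : ∀ v, (nbrs G v).card = 2) :
    Nonempty (G ≃g SimpleGraph.cycleGraph (Nat.card V)) := by
  have hset : ∀ v, G.neighborSet v = nbrs G v := fun v => by
    ext w
    simp [mem_nbrs]
  have hcyc : G.IsCycles := fun v _ => by rw [hset, Set.ncard_coe_finset, h2]
  obtain ⟨v⟩ := hG.nonempty
  obtain ⟨p, hp, hverts⟩ := hcyc.exists_cycle_toSubgraph_verts_eq_connectedComponentSupp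
    (c := G.connectedComponentMk v) (v := v) rfl (by
      rw [hset, Finset.coe_nonempty, ← Finset.card_pos, h2]
      norm_num)
  have hsupp : ∀ w, w ∈ p.support.tail := by
    intro w
    have hw : w ∈ p.toSubgraph.verts := by
      rw [hverts, SimpleGraph.ConnectedComponent.mem_supp_iff,
        SimpleGraph.ConnectedComponent.eq]
      exact hG.preconnected w v
    rw [SimpleGraph.Walk.mem_verts_toSubgraph] at hw
    rw [← SimpleGraph.Walk.cons_tail_support, List.mem_cons] at hw
    rcases hw with rfl | hw
    · exact SimpleGraph.Walk.end_mem_tail_support hp.not_nil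
    · exact hw
  have hlen : p.length = Nat.card V := by
    have h1 : p.support.tail.toFinset = Finset.univ := by
      ext w
      simp [hsupp w]
    have h3 := List.toFinset_card_of_nodup hp.support_nodup
    rw [h1, List.length_tail, SimpleGraph.Walk.length_support, Finset.card_univ] at h3
    rw [Nat.card_eq_fintype_card, h3]
    rfl
  obtain ⟨m, hm⟩ := Nat.exists_eq_add_of_le' hp.three_le_length
  rw [hlen] at hm
  rw [hm]
  obtain ⟨f⟩ := (SimpleGraph.cycleGraph_isContained_iff (G := G) (n := m + 3) (by lia)).2
    ⟨v, p, hp, hlen.trans hm⟩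
  have hbij : Function.Bijective f := by
    rw [Fintype.bijective_iff_injective_and_card]
    exact ⟨f.injective, by rw [Fintype.card_fin, ← hm, Nat.card_eq_fintype_card]⟩
  refine ⟨(⟨Equiv.ofBijective f hbij, ?_⟩ : SimpleGraph.cycleGraph (m + 3) ≃g G).symm⟩
  intro a b
  refine ⟨fun hadj => ?_, fun hadj => f.toHom.map_adj hadj⟩
  -- Both graphs are 2-regular, so the spanning copy of the cycle already uses every edge of `G`.
  have himg : ((SimpleGraph.cycleGraph (m + 3)).neighborFinset a).image f = nbrs G (f a) := by
    refine Finset.eq_of_subset_of_card_le ?_ ?_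
    · intro w hw
      obtain ⟨b, hb, rfl⟩ := Finset.mem_image.1 hw
      rw [SimpleGraph.mem_neighborFinset] at hb
      exact (mem_nbrs G).2 (f.toHom.map_adj hb)
    · rw [h2, Finset.card_image_of_injective (f := (f : Fin (m + 3) → V)) _ hbij.injective, SimpleGraph.card_neighborFinset_eq_degree,
        SimpleGraph.cycleGraph_degree_three_le]
  have hb : f b ∈ nbrs G (f a) := (mem_nbrs G).2 hadj
  rw [← himg, Finset.mem_image] at hb
  obtain ⟨b', hb', h⟩ := hb
  rw [f.injective h, SimpleGraph.mem_neighborFinset] at hb'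
  exact hb'

open Fin.CommRing in
theorem linearDefect_univ_of_cycle {m : ℕ} (e : G ≃g SimpleGraph.cycleGraph (m + 3)) :
    linearDefect G Finset.univ = 0 := by
  have hcard : Fintype.card V = m + 3 := by
    rw [Fintype.card_congr e.toEquiv, Fintype.card_fin]
  rw [linearDefect_eq_sum G (by rw [Finset.card_univ]; lia)]
  refine Finset.sum_eq_zero fun r _ => ?_
  have hcast : ∀ i j : ℕ, i ≤ m + 2 → j ≤ m + 2 →
      (((i : ℕ) : Fin (m + 3)) = ((j : ℕ) : Fin (m + 3)) ↔ i = j) := by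
    intro i j hi hj
    rw [Fin.ext_iff, Fin.val_natCast, Fin.val_natCast, Nat.mod_eq_of_lt (by lia),
      Nat.mod_eq_of_lt (by lia)]
  have hsucc : ∀ i j : ℕ, i ≤ m + 2 → j ≤ m + 2 →
      (((i : ℕ) : Fin (m + 3)) - ((j : ℕ) : Fin (m + 3)) = 1 ↔
        i = j + 1 ∨ i = 0 ∧ j = m + 2) := by
    intro i j hi hj
    rw [sub_eq_iff_eq_add', ← Nat.cast_add_one]
    rcases Nat.lt_or_ge j (m + 2) with h | h
    · rw [hcast i (j + 1) hi (by lia)]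
      lia
    · obtain rfl : j = m + 2 := by lia
      rw [show ((m + 2 + 1 : ℕ) : Fin (m + 3)) = ((0 : ℕ) : Fin (m + 3)) by simp,
        hcast i 0 hi (by lia)]
      lia
  -- The path left after deleting `r`, starting one step past `r`; its two ends are the neighbors of
  -- `r`.
  let p : ℕ → V := fun i => e.symm (e r + ((i + 1 : ℕ) : Fin (m + 3)))
  have hadj0 : ∀ i j : ℕ, i ≤ m + 2 → j ≤ m + 2 →
      (G.Adj (e.symm (e r + (i : Fin (m + 3)))) (e.symm (e r + (j : Fin (m + 3)))) ↔
        (i = j + 1 ∨ i = 0 ∧ j = m + 2) ∨ (j = i + 1 ∨ j = 0 ∧ i = m + 2)) := by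
    intro i j hi hj
    rw [e.symm.map_adj_iff, SimpleGraph.cycleGraph_adj, add_sub_add_left_eq_sub,
      add_sub_add_left_eq_sub, hsucc i j hi hj, hsucc j i hj hi]
  have h := excess_path_ends (G := G) (p := p) (m := m + 1)
    (fun i hi j hj h => by
      have := (hcast (i + 1) (j + 1) (by lia) (by lia)).1 (add_left_cancel (e.symm.injective h))
      lia)
    (fun i hi j hj => by
      rw [hadj0 (i + 1) (j + 1) (by lia) (by lia)]
      lia)
  have himg : (Finset.range (m + 1 + 1)).image p = Finset.univ.erase r := by
    refine Finset.eq_of_subset_of_card_le ?_ ?_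
    · intro v hv
      obtain ⟨i, hi, rfl⟩ := Finset.mem_image.1 hv
      rw [Finset.mem_range] at hi
      refine Finset.mem_erase.2 ⟨fun h => ?_, Finset.mem_univ _⟩
      have h' : e r + ((i + 1 : ℕ) : Fin (m + 3)) = e r :=
        (e.apply_symm_apply _).symm.trans (congrArg e h)
      have := (hcast (i + 1) 0 (by lia) (by lia)).1
        ((add_eq_left.1 h').trans Nat.cast_zero.symm)
      lia
    · rw [Finset.card_image_of_injOn, Finset.card_range, Finset.card_erase_of_mem (Finset.mem_univ r),
        Finset.card_univ, hcard]
      · lia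
      · intro i hi j hj h
        rw [Finset.coe_range, Set.mem_Iio] at hi hj
        have := (hcast (i + 1) (j + 1) (by lia) (by lia)).1
          (add_left_cancel (e.symm.injective h))
        lia
  rw [← himg, ← h]
  refine excess_congr G fun v hv => ?_
  obtain ⟨i, hi, rfl⟩ := Finset.mem_image.1 hv
  rw [Finset.mem_range] at hi
  have hp : ∀ j ≤ m + 1, p i = p j ↔ i = j := fun j hj =>
    ⟨fun h => by
      have := (hcast (i + 1) (j + 1) (by lia) (by lia)).1 (add_left_cancel (e.symm.injective h))
      lia, fun h => h ▸ rfl⟩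
  have h1 := hadj0 0 (i + 1) (by lia) (by lia)
  rw [Nat.cast_zero, add_zero, e.symm_apply_apply] at h1
  rw [mem_nbrs, Finset.mem_insert, Finset.mem_singleton, hp 0 (by lia), hp (m + 1) le_rfl]
  change G.Adj r (e.symm (e r + ((i + 1 : ℕ) : Fin (m + 3)))) ↔ _
  rw [h1]
  lia

end Cycle

/-! ### The equality cases -/

section Equality

variable {V : Type*} [Fintype V] [DecidableEq V] {G : SimpleGraph V}

theorem card_connectedComponent_le {N : Finset V} (h : Anchored G N Finset.univ) :
    Nat.card G.ConnectedComponent ≤ N.card := by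
  classical
  have hsurj : Function.Surjective fun v : N => G.connectedComponentMk v.1 := by
    intro c
    by_contra! hc
    obtain ⟨v, hv⟩ := c.exists_rep
    obtain ⟨u, hu, hN | ⟨w, -, hw, hadj⟩⟩ :=
      h (Finset.univ.filter fun w => G.connectedComponentMk w = c) (Finset.subset_univ _)
        ⟨v, Finset.mem_filter.2 ⟨Finset.mem_univ v, hv⟩⟩
    · exact hc ⟨u, hN⟩ (Finset.mem_filter.1 hu).2
    · simp only [Finset.mem_filter, Finset.mem_univ, true_and] at hu hw
      exact hw ((SimpleGraph.ConnectedComponent.sound hadj.symm.reachable).trans hu)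
  rw [← Nat.card_eq_finsetCard]
  exact Nat.card_le_card_of_surjective _ hsurj

theorem mem_of_reachable {U : Finset V} (hU : ∀ u ∈ U, ∀ w, G.Adj u w → w ∈ U) {u w : V}
    (hu : u ∈ U) (h : G.Reachable u w) : w ∈ U := by
  obtain ⟨p⟩ := h
  induction p with
  | nil => exact hu
  | cons hadj _ ih => exact ih (hU _ hu _ hadj)

theorem exists_anchored_representatives (G : SimpleGraph V) :
    ∃ R : Finset V, R.card = Nat.card G.ConnectedComponent ∧ Anchored G R Finset.univ ∧
      ∀ r ∈ R, ∀ r' ∈ R, G.Reachable r r' → r = r' := by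
  classical
  have : Fintype G.ConnectedComponent := Fintype.ofFinite _
  have hout : ∀ c : G.ConnectedComponent, G.connectedComponentMk c.out = c := Quot.out_eq
  refine ⟨Finset.univ.image fun c : G.ConnectedComponent => c.out, ?_, ?_, ?_⟩
  · rw [Finset.card_image_of_injective, Finset.card_univ, Nat.card_eq_fintype_card]
    intro c c' h
    rw [← hout c, ← hout c']
    exact congrArg _ h
  · intro U _ ⟨u, hu⟩
    by_contra! h
    have hmem : (G.connectedComponentMk u).out ∈ U := by
      refine mem_of_reachable (fun v hv w hadj => ?_) hu
        (SimpleGraph.ConnectedComponent.exact (hout _).symm)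
      by_contra hw
      exact (h v hv).2 w (Finset.mem_univ w) hw hadj
    exact (h _ hmem).1 (Finset.mem_image_of_mem _ (Finset.mem_univ _))
  · intro r hr r' hr' h
    obtain ⟨c, -, rfl⟩ := Finset.mem_image.1 hr
    obtain ⟨c', -, rfl⟩ := Finset.mem_image.1 hr'
    have := SimpleGraph.ConnectedComponent.sound h
    rw [hout, hout] at this
    rw [this]

theorem exists_component (G : SimpleGraph V) (r : V) :
    ∃ C : Finset V, r ∈ C ∧ Anchored G {r} C ∧ (∀ u ∈ C, ∀ w, G.Adj u w → w ∈ C) ∧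
      ∀ w ∈ C, G.Reachable r w := by
  classical
  have hclosed : ∀ u ∈ Finset.univ.filter (G.Reachable r), ∀ w, G.Adj u w →
      w ∈ Finset.univ.filter (G.Reachable r) := by
    simp only [Finset.mem_filter, Finset.mem_univ, true_and]
    exact fun u hu w hadj => hu.trans hadj.reachable
  refine ⟨Finset.univ.filter (G.Reachable r), by simp, ?_, hclosed, by simp⟩
  intro U hU ⟨u, hu⟩
  by_contra! h
  have hr : r ∈ U := by
    refine mem_of_reachable (fun v hv w hadj => ?_) hu (Finset.mem_filter.1 (hU hu)).2.symm
    by_contra hw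
    exact (h v hv).2 w (hclosed v (hU hv) w hadj) hw hadj
  exact (h r hr).1 (Finset.mem_singleton_self r)

theorem Anchored.compl_component {R C : Finset V} {r : V} (h : Anchored G R Finset.univ)
    (hr : r ∈ C) (hC : ∀ u ∈ C, ∀ w, G.Adj u w → w ∈ C) :
    Anchored G (R.erase r) (Finset.univ \ C) := by
  intro U hU hne
  obtain ⟨u, hu, h'⟩ := h U (Finset.subset_univ U) hne
  have huC : u ∉ C := (Finset.mem_sdiff.1 (hU hu)).2
  refine ⟨u, hu, h'.imp (fun h => Finset.mem_erase.2 ⟨fun h => huC (h ▸ hr), h⟩) ?_⟩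
  rintro ⟨w, hw, hwU, hadj⟩
  exact ⟨w, Finset.mem_sdiff.2 ⟨hw, fun h => huC (hC w h u hadj.symm)⟩, hwU, hadj⟩

/-- An anchoring set stays anchoring when enlarged, so it can be extended inside `S` to exactly `j`
vertices. -/
theorem q_pos_of_card_le {N S : Finset V} {j : ℕ} (h : Anchored G N S) (hN : N.card ≤ j)
    (hj : j ≤ S.card) : 0 < q G ∅ S j := by
  obtain ⟨M, hNM, hMS, rfl⟩ := Finset.exists_subsuperset_card_eq (s := N ∩ S) (t := S)
    Finset.inter_subset_right ((Finset.card_le_card Finset.inter_subset_left).trans hN) hj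
  refine q_pos hMS (h.mono fun v hv hvN => ?_)
  rw [Finset.empty_union]
  exact hNM (Finset.mem_inter.2 ⟨hvN, hv⟩)

theorem d_ne_zero {T : Finset V} {j : ℕ} (hT : 0 < linearDefect G T)
    (hq : 0 < q G ∅ (Finset.univ \ T) j) : d G (j + 1) ≠ 0 := by
  rw [Ne, d_eq_zero_iff]
  exact fun h => (h T).elim hT.ne' hq.ne'

/-- The witness `T` is another component together with `v`; the rest of `G` has exactly `j`
components. -/
theorem d_ne_zero_of_isolated {j : ℕ} (hc : j + 2 = Nat.card G.ConnectedComponent) {v : V}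
    (hv : G.IsIsolated v) : d G (j + 1) ≠ 0 := by
  obtain ⟨R, hRc, hR, hRr⟩ := exists_anchored_representatives G
  have hvR : v ∈ R := by
    obtain ⟨u, hu, h | ⟨w, -, -, hadj⟩⟩ :=
      hR {v} (Finset.subset_univ _) (Finset.singleton_nonempty v)
    · exact Finset.mem_singleton.1 hu ▸ h
    · exact absurd hadj (Finset.mem_singleton.1 hu ▸ hv w)
  obtain ⟨r, hr, hrv⟩ := Finset.exists_mem_ne (by lia : 1 < R.card) v
  obtain ⟨C, hrC, hC, hclosed, hreach⟩ := exists_component G r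
  have hvC : v ∉ C := fun h => hrv (hRr r hr v hvR (hreach v h))
  refine d_ne_zero (linearDefect_pos_of_isolated hrC hC hvC fun w _ hadj => hv w hadj.symm) ?_
  have hN : ((R.erase r).erase v).card = j := by
    rw [Finset.card_erase_of_mem (Finset.mem_erase.2 ⟨hrv.symm, hvR⟩),
      Finset.card_erase_of_mem hr]
    lia
  refine q_pos_of_card_le (N := (R.erase r).erase v) ?_ hN.le (hN.ge.trans ?_)
  · intro U hU hne
    have hsub : Finset.univ \ (C ∪ {v}) ⊆ Finset.univ \ C :=
      Finset.sdiff_subset_sdiff subset_rfl Finset.subset_union_left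
    have hUv : ∀ u ∈ U, u ≠ v := fun u hu h => by
      have := hU hu
      simp [h] at this
    obtain ⟨u, hu, h⟩ := hR.compl_component hrC hclosed U (hU.trans hsub) hne
    refine ⟨u, hu, h.imp (fun h => Finset.mem_erase.2 ⟨hUv u hu, h⟩) ?_⟩
    rintro ⟨w, hw, hwU, hadj⟩
    refine ⟨w, ?_, hwU, hadj⟩
    have hwv : w ≠ v := fun h => hv u (h ▸ hadj.symm)
    simpa [hwv] using hw
  · refine Finset.card_le_card fun w hw => ?_
    simp only [Finset.mem_erase] at hw
    have : w ∉ C := fun h => hw.2.1 (hRr r hr w hw.2.2 (hreach w h)).symm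
    simp [this, hw.1]

theorem card_univ_sdiff_pair {x y : V} (hxy : x ≠ y) :
    (Finset.univ \ ({x} ∪ {y}) : Finset V).card + 2 = Nat.card V := by
  rw [Nat.card_eq_fintype_card, ← Finset.card_univ,
    ← Finset.card_sdiff_add_card_eq_card (Finset.subset_univ ({x} ∪ {y} : Finset V)),
    ← Finset.insert_eq, Finset.card_pair hxy]

theorem d_ne_zero_of_disconnected {j : ℕ} (h2 : 2 ≤ Nat.card G.ConnectedComponent)
    (hc : Nat.card G.ConnectedComponent ≤ j + 1) (hj : j + 1 < Nat.card V) :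
    d G (j + 1) ≠ 0 := by
  obtain ⟨R, hRc, hR, hRr⟩ := exists_anchored_representatives G
  rw [Nat.card_eq_fintype_card (α := V), ← Finset.card_univ] at hj
  rw [← hRc] at h2 hc
  -- A spare vertex `w` outside the representatives: choosing `C` to avoid it leaves at least `|R|`
  -- vertices outside `C`, enough to remove one more.
  obtain ⟨w, -, hw⟩ := Finset.exists_mem_notMem_of_card_lt_card
    (by lia : R.card < (Finset.univ : Finset V).card)
  obtain ⟨r, hr, hrw⟩ : ∃ r ∈ R, ¬ G.Reachable r w := by
    by_contra! h
    obtain ⟨x, hx, y, hy, hxy⟩ := Finset.one_lt_card.1 (by lia : 1 < R.card)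
    exact hxy (hRr x hx y hy ((h x hx).trans (h y hy).symm))
  obtain ⟨C, hrC, hC, hclosed, hreach⟩ := exists_component G r
  have hwC : w ∉ C := fun h => hrw (hreach w h)
  have hcompl : R.card ≤ (Finset.univ \ C).card := by
    calc R.card = (insert w (R.erase r)).card := by
          rw [Finset.card_insert_of_notMem fun h => hw (Finset.mem_of_mem_erase h),
            Finset.card_erase_add_one hr]
      _ ≤ (Finset.univ \ C).card := by
          refine Finset.card_le_card fun x hx => ?_
          rw [Finset.mem_sdiff]
          refine ⟨Finset.mem_univ x, fun hxC => ?_⟩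
          rcases Finset.mem_insert.1 hx with rfl | hx
          · exact hwC hxC
          · exact Finset.ne_of_mem_erase hx
              (hRr r hr x (Finset.mem_of_mem_erase hx) (hreach x hxC)).symm
  obtain ⟨y, hy, hancy⟩ := (hR.compl_component hrC hclosed).exists_erase_of_nonempty
    (Finset.card_pos.1 (by lia))
  have hyC : y ∉ C := (Finset.mem_sdiff.1 hy).2
  rcases Nat.lt_or_ge j R.card with hjR | hjR
  · refine d_ne_zero (linearDefect_pos_of_isolated hrC hC hyC
      fun w hw hadj => hyC (hclosed w hw y hadj)) ?_
    have hS : Finset.univ \ (C ∪ {y}) = (Finset.univ \ C).erase y := by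
      ext x
      simp only [Finset.mem_sdiff, Finset.mem_univ, Finset.mem_union, Finset.mem_singleton,
        Finset.mem_erase]
      tauto
    rw [hS]
    refine q_pos_of_card_le hancy ?_ ?_
    · rw [Finset.card_erase_of_mem hr]
      lia
    · rw [Finset.card_erase_of_mem hy]
      lia
  -- Now `j` is at least the number of components, and `T = {x, y}` works: both vertices are
  -- removable, so `R` still anchors the rest.
  · obtain ⟨x, hx, hancx⟩ := hC.exists_erase_of_nonempty ⟨r, hrC⟩
    have hyx : y ≠ x := fun h => hyC (h ▸ hx)
    refine d_ne_zero (linearDefect_pos_of_isolated (C := {x}) (x := y) (Finset.mem_singleton_self x)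
      (anchored_of_subset subset_rfl) (by simpa using hyx) (fun w hw hadj => ?_)) ?_
    · exact hyC (hclosed x hx y (Finset.mem_singleton.1 hw ▸ hadj))
    · have hS : Finset.univ \ ({x} ∪ {y}) = C.erase x ∪ (Finset.univ \ C).erase y := by
        ext z
        have h1 : z = x → z ∈ C := fun h => h ▸ hx
        have h2 : z = y → z ∉ C := fun h => h ▸ hyC
        simp only [Finset.mem_sdiff, Finset.mem_univ, Finset.mem_union, Finset.mem_singleton,
          Finset.mem_erase]
        tauto
      have hcard := card_univ_sdiff_pair hyx.symm
      rw [Nat.card_eq_fintype_card, ← Finset.card_univ] at hcard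
      refine q_pos_of_card_le (N := {r} ∪ R.erase r) (hS ▸ hancx.union hancy) ?_ (by lia)
      rw [← Finset.insert_eq, Finset.insert_erase hr]
      exact hjR

theorem univ_sdiff_pair (x y : V) :
    (Finset.univ \ ({x} ∪ {y}) : Finset V) = (Finset.univ.erase x).erase y := by
  ext z
  simp only [Finset.mem_sdiff, Finset.mem_univ, Finset.mem_union, Finset.mem_singleton,
    Finset.mem_erase]
  tauto

theorem linearDefect_nonadjacent_pos {x y : V} (hxy : x ≠ y) (hadj : ¬ G.Adj x y) :
    0 < linearDefect G ({x} ∪ {y}) :=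
  linearDefect_pos_of_isolated (Finset.mem_singleton_self x) (anchored_of_subset subset_rfl)
    (by simpa using hxy.symm) (by simpa using hadj)

theorem d_ne_zero_of_pair (hconn : ∀ r, Anchored G {r} Finset.univ) {j : ℕ}
    (hj : j + 1 < Nat.card V) {x y r : V} (hxy : x ≠ y) (hadj : ¬ G.Adj x y)
    (hr : r ∈ (Finset.univ.erase x).erase y)
    (hanc : Anchored G {r} ((Finset.univ.erase x).erase y)) : d G (j + 1) ≠ 0 := by
  simp only [Finset.mem_erase, Finset.mem_univ, and_true] at hr
  rcases Nat.eq_zero_or_pos j with rfl | hj0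
  -- For `j = 0` the complement of `T` must be empty, so `T` is everything; connectedness supplies
  -- the neighbors of `x` and `y` in the remaining set.
  · have hnbr : ∀ z z' : V, z ≠ r → ¬ G.Adj z z' → ∃ w, w ≠ z ∧ w ≠ z' ∧ G.Adj w z := by
      intro z z' hz hzz'
      obtain ⟨u, hu, h | ⟨w, -, hw, hadj⟩⟩ :=
        hconn r {z} (Finset.subset_univ _) (Finset.singleton_nonempty z)
      · rw [Finset.mem_singleton] at hu h
        exact absurd (hu.symm.trans h) hz
      · rw [Finset.mem_singleton] at hu hw
        subst hu
        exact ⟨w, hw, fun h => hzz' (h ▸ hadj), hadj.symm⟩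
    obtain ⟨w, hw1, hw2, hwx⟩ := hnbr x y hr.2.symm hadj
    obtain ⟨w', hw1', hw2', hwy⟩ := hnbr y x hr.1.symm fun h => hadj h.symm
    refine d_ne_zero (linearDefect_pos_of_pair (x := x) (y := y) (by simpa using hr) hanc (by simp)
      (by simp) hxy hadj ⟨w, by simp [hw1, hw2], hwx⟩ ⟨w', by simp [hw1', hw2'], hwy⟩) ?_
    have : Finset.univ \ ((Finset.univ.erase x).erase y ∪ {x, y}) = ∅ := by
      ext z
      simp
      tauto
    rw [this, q_empty]
    norm_num
  · have := card_univ_sdiff_pair hxy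
    exact d_ne_zero (linearDefect_nonadjacent_pos hxy hadj)
      (q_pos_of_card_le (N := {r}) (by rwa [univ_sdiff_pair]) (by rwa [Finset.card_singleton]) (by lia))

theorem d_ne_zero_of_no_pair (hG : G ≠ ⊤) (hconn : ∀ r, Anchored G {r} Finset.univ)
    (hpair : ∀ x y, x ≠ y → ¬ G.Adj x y → ∀ r ∈ (Finset.univ.erase x).erase y,
      ¬ Anchored G {r} ((Finset.univ.erase x).erase y)) {j : ℕ}
    (hj0 : 0 < j) (hj : j + 1 < Nat.card V) : d G (j + 1) ≠ 0 := by
  have h2 := card_nbrs_of_no_pair hG hconn hpair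
  have : Nonempty V := (Nat.card_pos_iff.1 (by lia : 0 < Nat.card V)).1
  obtain ⟨x⟩ := this
  obtain ⟨y, hyx, hadj⟩ := exists_not_adj_of_no_pair hG hpair x
  rcases Nat.lt_or_ge 1 j with hj1 | hj1
  · have := card_univ_sdiff_pair hyx
    refine d_ne_zero (linearDefect_nonadjacent_pos hyx fun h => hadj h.symm)
      (q_pos_of_card_le (N := nbrs G x) ?_ ?_ (by lia))
    · have hx : x ∈ (Finset.univ.erase y : Finset V) := by simp [hyx.symm]
      rw [univ_sdiff_pair]
      refine ((anchored_step (Finset.mem_singleton_self x) hx).1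
        (anchored_erase_of_no_pair hconn hpair hyx.symm)).mono fun v hv h => ?_
      simpa [Finset.ne_of_mem_erase hv] using h
    · rw [h2]
      exact hj1
  -- Here `T` is everything but a neighbor `v` of `x`. In `G - v` the only neighbor of `x` is `m`,
  -- so `x` is removable; a further removable `x' ≠ m` is then nonadjacent to `x`.
  · obtain rfl : j = 1 := by lia
    have hcard : 4 ≤ Nat.card V := by
      have : ({x, y} ∪ nbrs G x).card = 4 := by
        rw [Finset.card_union_of_disjoint, h2, Finset.card_pair hyx.symm]
        simp [mem_nbrs, hadj]
      rw [← this, Nat.card_eq_fintype_card]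
      exact Finset.card_le_univ _
    obtain ⟨v, hv⟩ := Finset.card_pos.1 (by rw [h2 x]; norm_num : 0 < (nbrs G x).card)
    rw [mem_nbrs] at hv
    obtain ⟨m, hm, hmv⟩ := Finset.exists_mem_ne (by rw [h2 x]; norm_num : 1 < (nbrs G x).card) v
    have hnbrs : nbrs G x = {v, m} := by
      refine (Finset.eq_of_subset_of_card_le ?_ ?_).symm
      · intro w hw
        rcases Finset.mem_insert.1 hw with rfl | hw
        · exact (mem_nbrs G).2 hv
        · exact Finset.mem_singleton.1 hw ▸ hm
      · rw [h2, Finset.card_pair hmv.symm]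
    rw [mem_nbrs] at hm
    have hx : ∀ w, G.Adj x w → w = v ∨ w = m := fun w hw => by
      simpa [hnbrs] using (mem_nbrs G).2 hw
    have hanc : Anchored G {m} ((Finset.univ.erase v).erase x) := by
      intro U hU hne
      obtain ⟨u, hu, h | ⟨w, hw, hwU, huw⟩⟩ := anchored_erase_of_no_pair hconn hpair hmv U
        (hU.trans (Finset.erase_subset _ _)) hne
      · exact ⟨u, hu, Or.inl h⟩
      · refine ⟨u, hu, ?_⟩
        by_cases hwx : w = x
        · subst hwx
          have := hU hu
          simp only [Finset.mem_erase, Finset.mem_univ, and_true] at this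
          exact Or.inl (Finset.mem_singleton.2 ((hx u huw.symm).resolve_left this.2))
        · exact Or.inr ⟨w, Finset.mem_erase.2 ⟨hwx, hw⟩, hwU, huw⟩
    have hS : ((Finset.univ.erase v).erase x : Finset V).card + 2 = Nat.card V := by
      rw [← univ_sdiff_pair, card_univ_sdiff_pair hv.ne']
    obtain ⟨x', hx', hx'm, hanc'⟩ := hanc.exists_erase fun h => by
      have := Finset.card_le_card h
      rw [Finset.card_singleton] at this
      lia
    have hx'' := hx'
    rw [Finset.mem_singleton] at hx'm
    simp only [Finset.mem_erase, Finset.mem_univ, and_true] at hx''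
    have hmC : m ∈ ((Finset.univ.erase v).erase x).erase x' := by
      simp [Ne.symm hx'm, hm.ne', hmv]
    have hx'C : ∃ w ∈ ((Finset.univ.erase v).erase x).erase x', G.Adj w x' := by
      obtain ⟨u, hu, h | ⟨w, hw, hwU, huw⟩⟩ :=
        hanc {x'} (by simpa using hx'') (Finset.singleton_nonempty x')
      · rw [Finset.mem_singleton] at hu h
        exact absurd (hu.symm.trans h) hx'm
      · rw [Finset.mem_singleton] at hu hwU
        subst hu
        exact ⟨w, Finset.mem_erase.2 ⟨hwU, hw⟩, huw.symm⟩
    refine d_ne_zero (linearDefect_pos_of_pair (x := x) (y := x') hmC hanc' (by simp) (by simp)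
      hx''.1.symm (fun h => (hx x' h).elim hx''.2 hx'm) ⟨m, hmC, hm.symm⟩ hx'C)
      (q_pos_of_card_le (N := {v}) (anchored_of_subset ?_) (by simp) ?_)
    · intro z hz
      simp only [Finset.mem_sdiff, Finset.mem_univ, Finset.mem_union, Finset.mem_erase,
        Finset.mem_insert, Finset.mem_singleton] at hz ⊢
      tauto
    · refine Finset.card_pos.2 ⟨v, ?_⟩
      simp [hv.ne', hx''.2.symm]

theorem connected_of_anchored {r : V} (h : Anchored G {r} Finset.univ) : G.Connected := by
  classical
  have hr : ∀ v, G.Reachable r v := by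
    by_contra! hv
    obtain ⟨v, hv⟩ := hv
    obtain ⟨u, hu, h | ⟨w, -, hw, hadj⟩⟩ :=
      h (Finset.univ.filter fun w => ¬ G.Reachable r w) (Finset.subset_univ _)
        ⟨v, by simpa using hv⟩
    · rw [Finset.mem_singleton] at h
      simp [h] at hu
    · simp only [Finset.mem_filter, Finset.mem_univ, true_and, not_not] at hu hw
      exact hu (hw.trans hadj.symm.reachable)
  have : Nonempty V := ⟨r⟩
  exact ⟨fun v w => (hr v).symm.trans (hr w)⟩

theorem d_ne_zero_of_connected (hG : G ≠ ⊤) (hc : Nat.card G.ConnectedComponent = 1) {j : ℕ}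
    (hj : j + 1 < Nat.card V)
    (hcycle : j = 0 → ¬ Nonempty (G ≃g SimpleGraph.cycleGraph (Nat.card V))) :
    d G (j + 1) ≠ 0 := by
  obtain ⟨R, hRc, hR, -⟩ := exists_anchored_representatives G
  rw [hc, Finset.card_eq_one] at hRc
  obtain ⟨r₀, rfl⟩ := hRc
  have hconn : ∀ r, Anchored G {r} Finset.univ := fun r => hR.reroot (Finset.mem_univ r)
  by_cases hpair : ∀ x y, x ≠ y → ¬ G.Adj x y → ∀ r ∈ (Finset.univ.erase x).erase y,
      ¬ Anchored G {r} ((Finset.univ.erase x).erase y)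
  · refine d_ne_zero_of_no_pair hG hconn hpair (Nat.pos_of_ne_zero fun h => ?_) hj
    exact hcycle h (nonempty_iso_cycleGraph (connected_of_anchored hR)
      (card_nbrs_of_no_pair hG hconn hpair))
  · push Not at hpair
    obtain ⟨x, y, hxy, hadj, r, hr, hanc⟩ := hpair
    exact d_ne_zero_of_pair hconn hj hxy hadj hr hanc

theorem eq_top_of_iso_cycleGraph {n : ℕ} (e : G ≃g SimpleGraph.cycleGraph n) (hn : n < 3) :
    G = ⊤ := by
  have htop : SimpleGraph.cycleGraph n = ⊤ := by
    interval_cases n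
    · exact SimpleGraph.cycleGraph_zero_eq_top
    · exact SimpleGraph.cycleGraph_one_eq_top
    · exact SimpleGraph.cycleGraph_two_eq_top
  refine top_le_iff.1 fun x y hxy => ?_
  refine e.map_adj_iff.1 ?_
  simp only [htop, SimpleGraph.top_adj]
  exact fun h => hxy (e.injective h)

theorem d_eq_zero_of_cases (hG : G ≠ ⊤) {j : ℕ}
    (h : j + 1 = Nat.card V ∨ j + 3 ≤ Nat.card G.ConnectedComponent ∨
      (j + 2 = Nat.card G.ConnectedComponent ∧ ∀ v : V, ¬ G.IsIsolated v) ∨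
      (j = 0 ∧ Nonempty (G ≃g SimpleGraph.cycleGraph (Nat.card V)))) :
    d G (j + 1) = 0 := by
  rw [d_eq_zero_iff]
  by_contra! hT
  obtain ⟨T, hT, hq⟩ := hT
  obtain ⟨M, hMS, hM, hanc⟩ := exists_anchored_of_q_ne_zero hq
  rw [Finset.empty_union] at hanc
  obtain ⟨u, hu, r, hr, hrT⟩ := exists_anchored_of_linearDefect_ne_zero hT
  have hTS : Finset.univ \ T ∪ T.erase u = Finset.univ.erase u := by
    ext z
    have : z = u → z ∈ T := fun h => h ▸ hu
    simp only [Finset.mem_union, Finset.mem_sdiff, Finset.mem_univ, Finset.mem_erase]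
    tauto
  -- A nonzero term thus makes at most `j + 1` vertices meet every component of `G - u`. Hence `G`
  -- has at most `j + 2` components, and at most `j + 1` unless `u` is isolated.
  have hMr : Anchored G (M ∪ {r}) (Finset.univ.erase u) := hTS ▸ hanc.union hrT
  have hcard : (M ∪ {r}).card ≤ j + 1 := by
    refine (Finset.card_union_le _ _).trans ?_
    rw [hM, Finset.card_singleton]
  rcases h with h | h | ⟨h, hiso⟩ | ⟨rfl, ⟨e⟩⟩
  · have h1 := Finset.card_le_card hMS
    have h2 := Finset.card_sdiff_add_card_eq_card (Finset.subset_univ T)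
    rw [Finset.card_univ, ← Nat.card_eq_fintype_card] at h2
    exact hT (linearDefect_eq_zero G (by lia))
  · have h1 := (hMr.mono fun v _ hv => Finset.mem_insert_of_mem (b := u) hv).insert_mem
      (Finset.mem_insert_self u (M ∪ {r}))
    rw [Finset.insert_erase (Finset.mem_univ u)] at h1
    have h2 := card_connectedComponent_le h1
    have h3 := Finset.card_insert_le u (M ∪ {r})
    lia
  · have hadj := hiso u
    rw [SimpleGraph.IsIsolated] at hadj
    push Not at hadj
    obtain ⟨w, hw⟩ := hadj
    have h1 := hMr.insert_adj ⟨w, Finset.mem_erase.2 ⟨hw.ne', Finset.mem_univ w⟩, hw⟩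
    rw [Finset.insert_erase (Finset.mem_univ u)] at h1
    have h2 := card_connectedComponent_le h1
    lia
  -- With `j = 0` the set `M` is empty, and it can anchor the complement of `T` only if that is
  -- empty.
  · have hTuniv : T = Finset.univ := by
      by_contra hne
      have hne' : (Finset.univ \ T).Nonempty :=
        Finset.sdiff_nonempty.2 fun h => hne (Finset.univ_subset_iff.1 h)
      obtain ⟨v, hv, h | ⟨w, hw, hw', _⟩⟩ := hanc _ subset_rfl hne'
      · simp [Finset.card_eq_zero.1 hM] at h
      · exact hw' hw
    rw [hTuniv] at hT
    obtain ⟨m, hm⟩ := Nat.exists_eq_add_of_le' (by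
      by_contra h
      exact hG (eq_top_of_iso_cycleGraph e (by lia)) : 3 ≤ Nat.card V)
    rw [hm] at e
    exact hT (linearDefect_univ_of_cycle e)

end Equality

end ChromaticCoeff

theorem mainTheorem5 {V : Type*} [Fintype V] (G : SimpleGraph V) (hG : G ≠ ⊤)
    (n c : ℕ) (hn : n = Nat.card V) (hc : c = Nat.card G.ConnectedComponent) :
    ∀ i : ℕ, 1 ≤ i → i ≤ n →
      0 ≤ ChromaticCoeff.d G i ∧
      (ChromaticCoeff.d G i = 0 ↔
        i = n ∨
        i + 2 ≤ c ∨
        (i + 1 = c ∧ ∀ v : V, ¬ G.IsIsolated v) ∨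
        (i = 1 ∧ c = 1 ∧ Nonempty (G ≃g SimpleGraph.cycleGraph n))) := by
  classical
  intro i hi hin
  obtain ⟨j, rfl⟩ := Nat.exists_eq_add_of_le' hi
  subst hn hc
  refine ⟨ChromaticCoeff.d_nonneg G j, fun h0 => ?_, fun h => ?_⟩
  · by_contra! h
    obtain ⟨hn, hc, hiso, hcycle⟩ := h
    have hV : Nonempty V := (Nat.card_pos_iff.1 (by lia : 0 < Nat.card V)).1
    have hpos : 0 < Nat.card G.ConnectedComponent :=
      Nat.card_pos_iff.2 ⟨⟨G.connectedComponentMk hV.some⟩, inferInstance⟩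
    rcases Nat.lt_or_ge (j + 1) (Nat.card G.ConnectedComponent) with hjc | hjc
    · obtain ⟨v, hv⟩ := hiso (by lia)
      exact ChromaticCoeff.d_ne_zero_of_isolated (by lia) hv h0
    · rcases Nat.lt_or_ge 1 (Nat.card G.ConnectedComponent) with h1 | h1
      · exact ChromaticCoeff.d_ne_zero_of_disconnected h1 hjc (by lia) h0
      · refine ChromaticCoeff.d_ne_zero_of_connected hG (by lia) (by lia) (fun hj he => ?_) h0
        exact (hcycle (by lia) (by lia)).false he.some
  · refine ChromaticCoeff.d_eq_zero_of_cases hG ?_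
    rcases h with h | h | h | ⟨h, -, he⟩
    · exact Or.inl h
    · exact Or.inr (Or.inl (by lia))
    · exact Or.inr (Or.inr (Or.inl ⟨by lia, h.2⟩))
    · exact Or.inr (Or.inr (Or.inr ⟨by lia, he⟩))
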